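/- For all real constants $c_1, c_2, c_3$ with $c_1>0$ there are a word-RAM program $P$ and constants $C, c > 0$ and $n_0$, depending only on $c_1, c_2, c_3$, such that the following holds for all integers $n \ge n_0$, all $\ell$ with $c_1\log n \le \ell \le c_2 \log n$, and all real $t$ with $1 \le t \le \log n/\log\log n$ (logarithms to base $2$). Consider the word RAM with any word size $w = \Theta(\log n)$ in which a word can hold every answer, that is, $n 2^{\ell} \le 2^{w}$ and $w \le c_3\log n$. There is a static data structure that stores an arbitrary sequence of $n$ $\ell$-bit integers $a_1,\dots,a_n \in \{0,\dots,2^\ell-1\}$ in a number of memory words (depending only on $n,\ell,t,w$) that amounts to at most $$n\ell + \frac{n}{(\log n/t)^{c t}}$$ bits in total, all lookup tables included, and for which $P$, given $i \in\{1,\dots,n\}$ and read-only access to this memory, computes the partial sum $\sum_{j=1}^{i} a_j$ in at most $C t$ steps in the worst case. (In short: $n\ell + n/(\log n/t)^{\Omega(t)}$ bits of space and $O(t)$ query time for $\ell=\Theta(\log n)$ and $t\le \log n/\log\log n$.) -/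

import Mathlib

/-!
A word RAM with `w`-bit words and unit-cost instructions, on which the query algorithm of a static
data structure is run. The data structure is a read-only memory of `m` words; besides it a program
has only its registers, of which it mentions finitely many. (There is no instruction that writes to
the memory: a query may neither alter the data structure nor use further working memory, which
makes the existence of a program a stronger claim.)
-/

namespace WordRAM

/-- The arithmetic, bitwise and shift operations on words. -/
inductive BinOp where
  | add | sub | mul | div | mod | and | or | xor | shl | shr

/-- Words are unsigned integers modulo `2 ^ w`; a quotient by `0` is `0`, and a shift by `w` or more
places gives `0`. -/
def BinOp.eval {w : ℕ} (o : BinOp) (x y : BitVec w) : BitVec w :=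
  match o with
  | .add => x + y
  | .sub => x - y
  | .mul => x * y
  | .div => x / y
  | .mod => x % y
  | .and => x &&& y
  | .or => x ||| y
  | .xor => x ^^^ y
  | .shl => x <<< y.toNat
  | .shr => x >>> y.toNat

/-- The instructions; `d`, `a`, `b` are names of registers. -/
inductive Instr where
  /-- `R d := k` (modulo `2 ^ w`) -/
  | const (d k : ℕ)
  /-- `R d := R a ∘ R b` -/
  | op (o : BinOp) (d a b : ℕ)
  /-- `R d := M[R a]` -/
  | load (d a : ℕ)
  /-- `if R a < R b then goto target` (unsigned comparison) -/
  | jlt (a b target : ℕ)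
  /-- `if R a = R b then goto target` -/
  | jeq (a b target : ℕ)

/-- A program is a finite list of instructions; it does not depend on the word size. -/
abbrev Program := List Instr

/-- The state of the machine: the program counter and the contents of the registers. -/
structure Config (w : ℕ) where
  pc : ℕ
  reg : ℕ → BitVec w

/-- The word at an address of the memory; nothing is stored beyond the `m` words of the memory. -/
def readWord {w m : ℕ} (M : Fin m → BitVec w) (x : BitVec w) : BitVec w :=
  if h : x.toNat < m then M ⟨x.toNat, h⟩ else 0

/-- Execution of one instruction. -/
def exec {w m : ℕ} (M : Fin m → BitVec w) (s : Config w) : Instr → Config w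
  | .const d k => ⟨s.pc + 1, Function.update s.reg d (BitVec.ofNat w k)⟩
  | .op o d a b => ⟨s.pc + 1, Function.update s.reg d (o.eval (s.reg a) (s.reg b))⟩
  | .load d a => ⟨s.pc + 1, Function.update s.reg d (readWord M (s.reg a))⟩
  | .jlt a b target => ⟨if (s.reg a).toNat < (s.reg b).toNat then target else s.pc + 1, s.reg⟩
  | .jeq a b target => ⟨if s.reg a = s.reg b then target else s.pc + 1, s.reg⟩

/-- One step; a configuration whose program counter is outside the program has halted. -/
def step (P : Program) {w m : ℕ} (M : Fin m → BitVec w) (s : Config w) : Config w :=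
  match P[s.pc]? with
  | some I => exec M s I
  | none => s

/-- The machine starts at the first instruction, with the input word in register `0` and `0` in every
other register. -/
def start {w : ℕ} (x : BitVec w) : Config w :=
  ⟨0, fun r => if r = 0 then x else 0⟩

/-- On memory `M` and input word `x`, the program `P` halts after at most `T` steps, and then
register `0` holds the number `y`. -/
def ReturnsWithin (P : Program) {w m : ℕ} (M : Fin m → BitVec w) (x : BitVec w) (T : ℝ) (y : ℕ) :
    Prop :=
  ∃ k : ℕ, (k : ℝ) ≤ T ∧
    P.length ≤ ((step P M)^[k] (start x)).pc ∧
    (((step P M)^[k] (start x)).reg 0).toNat = y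

end WordRAM

/-- The memory `M` is a representation of the sequence `a 0, …, a (n - 1)` from which the program `P`
answers each of the `n` prefix-sum queries in at most `T` steps: on input `i`, where `1 ≤ i ≤ n`, it
returns the sum of the first `i` entries. -/
def AnswersPrefixSums (P : WordRAM.Program) {w m n ℓ : ℕ} (M : Fin m → BitVec w)
    (a : Fin n → Fin (2 ^ ℓ)) (T : ℝ) : Prop :=
  ∀ i : ℕ, 1 ≤ i → i ≤ n →
    WordRAM.ReturnsWithin P M (BitVec.ofNat w i) T
      (∑ j : Fin n with j.val < i, (a j).val)

/-! ### Machine words as residues of natural numbers -/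

/-! Put B = 2^β, κ = 6βD, E = 2^(ℓ-2βD); let S(i) be the prefix sums and U(i) = ⌊S(i)/E⌋. The answer
S(i+1) is U(i)·E + y(i) with y(i) < 2^ℓ + E. The lowest ℓ-κ bits of y(i) are stored verbatim. The
rest is a letter from an alphabet slightly larger than 2^κ, and the letter determines its label
U(i+1) - U(i). What remains is to find a leaf's letter and the sum of the labels before it.

The leaves are grouped into trees of branching factor B and depth D. A node replaces B letters by
one letter, which determines the sum of their labels, and exactly (B-1)κ bits stored at the node.
For this the B-tuples are sorted by label sum and cut into runs of 2^((B-1)κ); keeping the label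
determined by the run costs at most one extra letter per unit of label (`exists_label_splitting`,
`exists_tuple_code`). Labels are so small compared with 2^κ that the alphabets stay below 2^(κ+1) on
all levels (`alphabetSize_step`, `alphabetSize_le`). So a tree with N = B^D leaves wastes at most
two words, for U at its start and for its root letter (`layout_size_mul_le`).

A query descends D levels: a letter, the bits at its node and the index of a child are looked up in
tables that give the child's letter and the label sum of its left siblings (`queryProgram_returns`,
`exists_representation`). With L = log n, `exists_parameters` takes β about log(L/t)/2 and D about
16t, so that N exceeds (L/t)^(t/4) by a factor of order L while the tables stay near n^(1/4)
entries. -/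

theorem ofNat_sub_ofNat {w a b : ℕ} (h : b ≤ a) :
    BitVec.ofNat w a - BitVec.ofNat w b = BitVec.ofNat w (a - b) := by
  rw [sub_eq_iff_eq_add, ← BitVec.ofNat_add, Nat.sub_add_cancel h]

theorem ofNat_div_ofNat {w a b : ℕ} (ha : a < 2 ^ w) (hb : b < 2 ^ w) :
    BitVec.ofNat w a / BitVec.ofNat w b = BitVec.ofNat w (a / b) := by
  apply BitVec.eq_of_toNat_eq
  rw [BitVec.toNat_udiv, BitVec.toNat_ofNat, BitVec.toNat_ofNat, BitVec.toNat_ofNat,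
    Nat.mod_eq_of_lt ha, Nat.mod_eq_of_lt hb,
    Nat.mod_eq_of_lt ((Nat.div_le_self a b).trans_lt ha)]

theorem ofNat_mod_ofNat {w a b : ℕ} (ha : a < 2 ^ w) (hb : b < 2 ^ w) :
    BitVec.ofNat w a % BitVec.ofNat w b = BitVec.ofNat w (a % b) := by
  apply BitVec.eq_of_toNat_eq
  rw [BitVec.toNat_umod, BitVec.toNat_ofNat, BitVec.toNat_ofNat, BitVec.toNat_ofNat,
    Nat.mod_eq_of_lt ha, Nat.mod_eq_of_lt hb,
    Nat.mod_eq_of_lt ((Nat.mod_le a b).trans_lt ha)]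

/-- Since 2^f divides 2^w, a dividend that has overflowed still has the right residue; `a` therefore
needs no bound. -/
theorem ofNat_mod_two_pow {w a f : ℕ} (hf : f < w) :
    BitVec.ofNat w a % BitVec.ofNat w (2 ^ f) = BitVec.ofNat w (a % 2 ^ f) := by
  have h := Nat.pow_lt_pow_right (a := 2) (by norm_num) hf
  apply BitVec.eq_of_toNat_eq
  rw [BitVec.toNat_umod, BitVec.toNat_ofNat, BitVec.toNat_ofNat, BitVec.toNat_ofNat,
    Nat.mod_eq_of_lt h, Nat.mod_mod_of_dvd _ (pow_dvd_pow 2 hf.le),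
    Nat.mod_eq_of_lt ((Nat.mod_lt _ (by positivity)).trans h)]

theorem ofNat_shr {w a b : ℕ} (ha : a < 2 ^ w) (hb : b < 2 ^ w) :
    BitVec.ofNat w a >>> (BitVec.ofNat w b).toNat = BitVec.ofNat w (a / 2 ^ b) := by
  apply BitVec.eq_of_toNat_eq
  rw [BitVec.toNat_ushiftRight, BitVec.toNat_ofNat, BitVec.toNat_ofNat, BitVec.toNat_ofNat,
    Nat.mod_eq_of_lt ha, Nat.mod_eq_of_lt hb, Nat.shiftRight_eq_div_pow,
    Nat.mod_eq_of_lt ((Nat.div_le_self _ _).trans_lt ha)]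

theorem ofNat_shl {w a b : ℕ} (hb : b < 2 ^ w) :
    BitVec.ofNat w a <<< (BitVec.ofNat w b).toNat = BitVec.ofNat w (a * 2 ^ b) := by
  apply BitVec.eq_of_toNat_eq
  rw [BitVec.toNat_shiftLeft, BitVec.toNat_ofNat, BitVec.toNat_ofNat, BitVec.toNat_ofNat,
    Nat.mod_eq_of_lt hb, Nat.shiftLeft_eq, Nat.mod_mul_mod]

theorem readWord_ofNat {w m : ℕ} (mem : ℕ → ℕ) (hm : m ≤ 2 ^ w) {a : ℕ} (ha : a < m) :
    WordRAM.readWord (fun i : Fin m => BitVec.ofNat w (mem i)) (BitVec.ofNat w a) =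
      BitVec.ofNat w (mem a) := by
  have : (BitVec.ofNat w a).toNat = a := by
    rw [BitVec.toNat_ofNat, Nat.mod_eq_of_lt (ha.trans_le hm)]
  simp [WordRAM.readWord, Nat.mod_eq_of_lt (ha.trans_le hm), ha]

/-! ### Bit fields of a natural number -/

/-- A field of at most `w` bits is assembled from two consecutive `w`-bit digits. -/
theorem field_eq_two_digits (V w s i f : ℕ) (hs : s ≤ w) (hf : f ≤ w) :
    ((V / 2 ^ (w * i) % 2 ^ w) / 2 ^ s + (V / 2 ^ (w * (i + 1)) % 2 ^ w) * 2 ^ (w - s)) % 2 ^ f =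
      V / 2 ^ (w * i + s) % 2 ^ f := by
  rw [pow_add 2 (w * i) s, ← Nat.div_div_eq_div_mul, Nat.mul_succ, pow_add 2 (w * i) w,
    ← Nat.div_div_eq_div_mul]
  generalize V / 2 ^ (w * i) = Y
  have h2 : 2 ^ w = 2 ^ s * 2 ^ (w - s) := by rw [← pow_add, Nat.add_sub_cancel' hs]
  have h1 : Y / 2 ^ s = Y % 2 ^ w / 2 ^ s + Y / 2 ^ w * 2 ^ (w - s) := by
    conv_lhs => rw [← Nat.mod_add_div Y (2 ^ w)]
    conv_lhs => rw [h2, mul_assoc, ← h2, Nat.add_mul_div_left _ _ (by positivity), mul_comm]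
  rw [h1]
  -- Digits beyond the second contribute a multiple of 2^f, because f ≤ w.
  have h3 : Y / 2 ^ w * 2 ^ (w - s) =
      Y / 2 ^ w % 2 ^ w * 2 ^ (w - s) + 2 ^ f * (2 ^ (w - f) * (Y / 2 ^ w / 2 ^ w) * 2 ^ (w - s)) := by
    have h4 : 2 ^ w = 2 ^ f * 2 ^ (w - f) := by rw [← pow_add, Nat.add_sub_cancel' hf]
    conv_lhs => rw [← Nat.mod_add_div (Y / 2 ^ w) (2 ^ w)]
    conv_lhs => rw [add_mul]
    congr 1
    rw [← mul_assoc, ← mul_assoc, ← h4]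
  rw [h3, ← add_assoc, Nat.add_mul_mod_self_left]

/-- The number whose base-`2 ^ b` digits are `f 0, …, f (n - 1)`. -/
def packFields (b : ℕ) (f : ℕ → ℕ) (n : ℕ) : ℕ := ∑ i ∈ Finset.range n, f i * 2 ^ (b * i)

theorem packFields_lt (b : ℕ) {f : ℕ → ℕ} {n : ℕ} (hf : ∀ i < n, f i < 2 ^ b) :
    packFields b f n < 2 ^ (b * n) := by
  induction n with
  | zero => simp [packFields]
  | succ n ih =>
    have h := ih fun i hi => hf i (by omega)
    have h1 := hf n (by omega)
    rw [packFields, Finset.sum_range_succ, ← packFields, Nat.mul_succ, pow_add]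
    calc _ < 2 ^ (b * n) + f n * 2 ^ (b * n) := by omega
      _ = (f n + 1) * 2 ^ (b * n) := by ring
      _ ≤ 2 ^ b * 2 ^ (b * n) := Nat.mul_le_mul_right _ h1
      _ = _ := mul_comm _ _

theorem packFields_field (b : ℕ) {f : ℕ → ℕ} {n i : ℕ} (hf : ∀ i < n, f i < 2 ^ b) (hi : i < n) :
    packFields b f n / 2 ^ (b * i) % 2 ^ b = f i := by
  induction n with
  | zero => omega
  | succ n ih =>
    rw [packFields, Finset.sum_range_succ, ← packFields]
    have hf' : ∀ i < n, f i < 2 ^ b := fun i hi => hf i (by omega)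
    rcases Nat.lt_succ_iff_lt_or_eq.1 hi with h | rfl
    · obtain ⟨k, rfl⟩ : ∃ k, n = i + 1 + k := ⟨n - (i + 1), by omega⟩
      have : f (i + 1 + k) * 2 ^ (b * (i + 1 + k)) =
          2 ^ (b * i) * (2 ^ b * (f (i + 1 + k) * 2 ^ (b * k))) := by
        rw [Nat.mul_add, Nat.mul_succ, pow_add, pow_add]; ring
      rw [this, Nat.add_mul_div_left _ _ (by positivity), Nat.add_mul_mod_self_left]
      exact ih hf' h
    · rw [Nat.add_mul_div_right _ _ (by positivity), Nat.div_eq_of_lt (packFields_lt b hf'),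
        zero_add, Nat.mod_eq_of_lt (hf _ hi)]

/-! ### Straight-line code -/

namespace WordRAM

/-- The instructions that are not jumps. -/
def Instr.IsStraight : Instr → Prop
  | .jlt _ _ _ => False
  | .jeq _ _ _ => False
  | _ => True

/-- The registers after execution of a list of instructions in order. -/
def runRegs {w m : ℕ} (M : Fin m → BitVec w) : List Instr → (ℕ → BitVec w) → ℕ → BitVec w
  | [], R => R
  | I :: l, R => runRegs M l (exec M ⟨0, R⟩ I).reg

theorem iterate_step_straight {w m : ℕ} (M : Fin m → BitVec w) (P : Program) (l l' : List Instr)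
    (hl : ∀ I ∈ l, I.IsStraight) (pc : ℕ) (hP : P.drop pc = l ++ l') (R : ℕ → BitVec w) :
    (step P M)^[l.length] ⟨pc, R⟩ = ⟨pc + l.length, runRegs M l R⟩ := by
  induction l generalizing pc R with
  | nil => rfl
  | cons I l ih =>
    have h0 : P[pc]? = some I := by
      have := congrArg (fun x => x[0]?) hP
      simpa using this
    have h1 : P.drop (pc + 1) = l ++ l' := by
      rw [← List.drop_drop, hP]; rfl
    have h2 : step P M ⟨pc, R⟩ = ⟨pc + 1, (exec M ⟨0, R⟩ I).reg⟩ := by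
      have hI := hl I (by simp)
      simp only [step, h0]
      cases I <;> first | rfl | exact hI.elim
    rw [List.length_cons, Function.iterate_succ_apply, h2,
      ih (fun J hJ => hl J (by simp [hJ])) _ h1, runRegs]
    congr 1
    omega

/-- Read the field of bits at the bit position in register `23` of the array of words that starts
at the address in register `base`, and reduce it modulo register `modulus`. -/
def readField (base modulus : ℕ) : List Instr :=
  [.op .div 24 23 1, .op .mod 25 23 1, .op .add 24 24 base, .load 26 24, .op .add 24 24 18,
   .load 27 24, .op .shr 26 26 25, .op .sub 25 1 25, .op .shl 27 27 25, .op .add 26 26 27,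
   .op .mod 26 26 modulus]

/-- A field that starts at a word boundary needs no separate case: the second word is then shifted
by w places and vanishes. -/
theorem runRegs_readField {w m : ℕ} (M : Fin m → BitVec w) (R : ℕ → BitVec w)
    {base modulus a f pos V : ℕ} (hbase : base < 23) (hmod : modulus < 23) (hw : 0 < w)
    (hf : f < w) (hpos : pos < 2 ^ w)
    (h23 : R 23 = BitVec.ofNat w pos) (h1 : R 1 = BitVec.ofNat w w)
    (h18 : R 18 = BitVec.ofNat w 1) (hb : R base = BitVec.ofNat w a)
    (hF : R modulus = BitVec.ofNat w (2 ^ f))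
    (h0 : readWord M (BitVec.ofNat w (a + pos / w)) =
      BitVec.ofNat w (V / 2 ^ (w * (pos / w)) % 2 ^ w))
    (h0' : readWord M (BitVec.ofNat w (a + (pos / w + 1))) =
      BitVec.ofNat w (V / 2 ^ (w * (pos / w + 1)) % 2 ^ w)) :
    runRegs M (readField base modulus) R 26 = BitVec.ofNat w (V / 2 ^ pos % 2 ^ f) ∧
      ∀ r, r ≠ 24 → r ≠ 25 → r ≠ 26 → r ≠ 27 → runRegs M (readField base modulus) R r = R r := by
  have hww : w < 2 ^ w := Nat.lt_two_pow_self
  have hlt := Nat.mod_lt pos hw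
  constructor
  · simp only [readField, runRegs, exec, BinOp.eval, Function.update_apply, reduceIte,
      Nat.reduceEqDiff, show base ≠ 24 by omega, show base ≠ 25 by omega,
      show modulus ≠ 24 by omega, show modulus ≠ 25 by omega, show modulus ≠ 26 by omega,
      show modulus ≠ 27 by omega, h23, h1, h18, hb, hF, ofNat_div_ofNat hpos hww,
      ofNat_mod_ofNat hpos hww, ← BitVec.ofNat_add]
    rw [show pos / w + a + 1 = a + (pos / w + 1) by ring, show pos / w + a = a + pos / w by ring,
      h0, h0', ofNat_sub_ofNat hlt.le, ofNat_shr (Nat.mod_lt _ (by positivity)) (by omega),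
      ofNat_shl (by omega), ← BitVec.ofNat_add, ofNat_mod_two_pow hf,
      field_eq_two_digits _ _ _ _ _ hlt.le hf.le, Nat.div_add_mod]
  · intro r h1 h2 h3 h4
    simp only [readField, runRegs, exec, Function.update_apply, h1, h2, h3, h4, if_false]

end WordRAM

/-! ### Splitting off a part that determines a label -/

/-- The elements of a finite set can be written as pairs `(z, μ)` with `μ < m`, where the first
component determines a given label, and takes few values beyond those that are unavoidable. -/
theorem exists_label_splitting {n : ℕ} (f : Fin n → ℕ) {s m : ℕ} (hs : ∀ a, f a ≤ s) (hm : 0 < m) :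
    ∃ (e : Fin n → ℕ × ℕ) (lab : ℕ → ℕ), Function.Injective e ∧
      (∀ a, (e a).1 ≤ n / m + s ∧ (e a).2 < m ∧ lab (e a).1 = f a) ∧ ∀ z, lab z ≤ s := by
  classical
  let σ := Tuple.sort f
  have hσ : Monotone (f ∘ σ) := Tuple.monotone_sort f
  -- In sorted order the run number `i / m` and the label are both nondecreasing, so their sum
  -- determines each of them, and it is at most n/m + s.
  let e' : Fin n → ℕ × ℕ := fun i => ((i : ℕ) / m + f (σ i), (i : ℕ) % m)
  have key : ∀ i j : Fin n, (e' i).1 = (e' j).1 → (i : ℕ) / m = j / m ∧ f (σ i) = f (σ j) := by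
    intro i j hij
    simp only [e'] at hij
    rcases le_total i j with h | h
    · have h1 : (i : ℕ) / m ≤ j / m := Nat.div_le_div_right h
      have h2 : f (σ i) ≤ f (σ j) := hσ h
      omega
    · have h1 : (j : ℕ) / m ≤ i / m := Nat.div_le_div_right h
      have h2 : f (σ j) ≤ f (σ i) := hσ h
      omega
  refine ⟨fun a => e' (σ.symm a),
    fun z => if h : ∃ i, (e' i).1 = z then f (σ h.choose) else 0, ?_, ?_, ?_⟩
  · intro a b hab
    have h1 := (key _ _ (congrArg Prod.fst hab)).1
    have h2 : ((σ.symm a : Fin n) : ℕ) % m = (σ.symm b : Fin n) % m := congrArg Prod.snd hab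
    have h3 : ((σ.symm a : Fin n) : ℕ) = (σ.symm b : Fin n) := by
      rw [← Nat.div_add_mod (σ.symm a : Fin n) m, h1, h2, Nat.div_add_mod]
    exact σ.symm.injective (Fin.ext h3)
  · intro a
    refine ⟨?_, Nat.mod_lt _ hm, ?_⟩
    · simp only [e', Equiv.apply_symm_apply]
      exact Nat.add_le_add (Nat.div_le_div_right (Fin.is_lt _).le) (hs a)
    · have h : ∃ i, (e' i).1 = (e' (σ.symm a)).1 := ⟨_, rfl⟩
      simp only [dif_pos h]
      rw [(key _ _ h.choose_spec).2, Equiv.apply_symm_apply]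
  · intro z
    dsimp only
    split_ifs
    · exact hs _
    · omega

/-- `B` letters below `K` are encoded by one letter below `K'` and a number below `m`, such that the
new letter determines the sum of the labels. -/
theorem exists_tuple_code (B K K' s m : ℕ) (lab : ℕ → ℕ) (hlab : ∀ z, lab z ≤ s) (hm : 0 < m)
    (hK : K ^ B / m + B * s < K') :
    ∃ (lab' : ℕ → ℕ) (dec : ℕ → ℕ → ℕ → ℕ), (∀ z, lab' z ≤ B * s) ∧
      ∀ c : ℕ → ℕ, (∀ j < B, c j < K) → ∃ z μ, z < K' ∧ μ < m ∧
        lab' z = ∑ j ∈ Finset.range B, lab (c j) ∧ ∀ j < B, dec z μ j = c j := by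
  classical
  have hcard : Fintype.card (Fin B → Fin K) = K ^ B := by simp
  let ψ : (Fin B → Fin K) ≃ Fin (K ^ B) := Fintype.equivFinOfCardEq hcard
  obtain ⟨e, lab', he, h1, h2⟩ := exists_label_splitting (s := B * s) (m := m)
    (fun a => ∑ j, lab (ψ.symm a j)) (fun a => by
      calc ∑ j, lab (ψ.symm a j) ≤ ∑ _j : Fin B, s := Finset.sum_le_sum fun j _ => hlab _
        _ = B * s := by simp) hm
  refine ⟨lab', fun z μ j => if h : (∃ a, e a = (z, μ)) ∧ j < B then
    (ψ.symm h.1.choose ⟨j, h.2⟩ : ℕ) else 0, h2, ?_⟩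
  intro c hc
  let a : Fin (K ^ B) := ψ fun j => ⟨c j, hc j j.2⟩
  obtain ⟨h3, h4, h5⟩ := h1 a
  refine ⟨(e a).1, (e a).2, by omega, h4, ?_, ?_⟩
  · rw [h5, Finset.sum_range]
    simp [a]
  · intro j hj
    have h : (∃ b, e b = ((e a).1, (e a).2)) ∧ j < B := ⟨⟨a, rfl⟩, hj⟩
    dsimp only
    rw [dif_pos h, he h.1.choose_spec]
    simp [a]

/-! ### Growth of the alphabets along the levels -/

theorem one_add_pow_le_one_add {x : ℝ} (hx : 0 ≤ x) (b : ℕ) (h : 2 * b * x ≤ 1) :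
    (1 + x) ^ b ≤ 1 + 2 * b * x := by
  induction b with
  | zero => simp
  | succ b ih =>
    push_cast at h ⊢
    have h' : 2 * b * x ≤ 1 := by nlinarith
    have := ih h'
    rw [pow_succ]
    calc (1 + x) ^ b * (1 + x) ≤ (1 + 2 * b * x) * (1 + x) := by gcongr
      _ ≤ _ := by nlinarith

/-- Size of the alphabet at level `k` of a tree of branching factor `2 ^ β` and depth `D`. -/
def alphabetSize (β D k : ℕ) : ℕ := 2 ^ (6 * β * D) + 2 ^ (4 * β * D + (β + 2) * k)

/-- Let X be the excess of the level-k alphabet over 2^κ. Since 2BX ≤ 2^κ, taking the B-th power and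
dividing by 2^((B-1)κ) gives at most 2^κ + 2BX. Labels are at most X, so the label sums add less
than another 2BX. The excess thus grows by at most the factor 4B = 2^(β+2), whence the exponent
(β+2)k. -/
theorem alphabetSize_step {β D k : ℕ} (hβ : 2 ≤ β) (hk : k < D) :
    alphabetSize β D k ^ 2 ^ β / 2 ^ ((2 ^ β - 1) * (6 * β * D)) +
      2 ^ β * (2 ^ (2 * β * D) * (2 ^ β) ^ k) < alphabetSize β D (k + 1) := by
  obtain ⟨B, hB⟩ : ∃ B, 2 ^ β = B := ⟨_, rfl⟩
  have hB1 : 1 ≤ B := hB ▸ Nat.one_le_two_pow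
  have hq : (β + 2) * D ≤ 2 * β * D := Nat.mul_le_mul_right _ (by omega)
  have hk' : (β + 2) * k + (β + 2) ≤ (β + 2) * D := by
    rw [← Nat.mul_succ]; exact Nat.mul_le_mul_left _ hk
  -- The excess relative to 2^κ is 2^(-e).
  obtain ⟨e, he⟩ : ∃ e, 2 * β * D = (β + 2) * k + e := ⟨2 * β * D - (β + 2) * k, by omega⟩
  have heβ : β + 2 ≤ e := by omega
  set κ := 6 * β * D with hκ
  have hexp : 4 * β * D + (β + 2) * k + e = κ := by rw [add_assoc, ← he, hκ]; ring
  have h1 : alphabetSize β D k ^ B / 2 ^ ((B - 1) * κ) ≤ 2 ^ κ + 2 * B * 2 ^ (4 * β * D + (β + 2) * k) := by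
    apply Nat.div_le_of_le_mul
    have hx : (2 : ℝ) * B * (2 ^ e)⁻¹ ≤ 1 := by
      rw [← div_eq_mul_inv, div_le_one (by positivity)]
      have : 2 * B ≤ 2 ^ e := by
        calc 2 * B = 2 ^ (β + 1) := by rw [← hB]; ring
          _ ≤ 2 ^ e := Nat.pow_le_pow_right (by norm_num) (by omega)
      exact_mod_cast this
    have h := one_add_pow_le_one_add (x := (2 ^ e : ℝ)⁻¹) (by positivity) B hx
    have h2 : (2 : ℝ) ^ (4 * β * D + (β + 2) * k) = 2 ^ κ * (2 ^ e)⁻¹ := by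
      rw [← hexp, pow_add 2 _ e]
      field_simp
    have h3 : (2 : ℝ) ^ ((B - 1) * κ) * 2 ^ κ = (2 ^ κ) ^ B := by
      rw [← pow_add, ← pow_mul]
      congr 1
      obtain ⟨b, rfl⟩ : ∃ b, B = b + 1 := ⟨B - 1, by omega⟩
      simp; ring
    have : (alphabetSize β D k : ℝ) ^ B ≤
        2 ^ ((B - 1) * κ) * (2 ^ κ + 2 * B * 2 ^ (4 * β * D + (β + 2) * k)) := by
      unfold alphabetSize
      push_cast
      rw [← hκ, h2]
      calc ((2 : ℝ) ^ κ + 2 ^ κ * (2 ^ e)⁻¹) ^ B = (2 ^ κ) ^ B * (1 + (2 ^ e)⁻¹) ^ B := by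
            rw [← mul_pow]; ring
        _ ≤ (2 ^ κ) ^ B * (1 + 2 * B * (2 ^ e)⁻¹) := by gcongr
        _ = _ := by rw [← h3]; ring
    exact_mod_cast this
  have h4 : B * (2 ^ (2 * β * D) * B ^ k) < 2 * B * 2 ^ (4 * β * D + (β + 2) * k) := by
    have : 2 ^ (2 * β * D) * B ^ k ≤ 2 ^ (4 * β * D + (β + 2) * k) := by
      rw [← hB, ← pow_mul, ← pow_add]
      apply Nat.pow_le_pow_right (by norm_num)
      nlinarith [Nat.zero_le (β * D)]
    have h5 : 0 < 2 ^ (4 * β * D + (β + 2) * k) := by positivity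
    nlinarith
  have h6 : alphabetSize β D (k + 1) = 2 ^ κ + 4 * B * 2 ^ (4 * β * D + (β + 2) * k) := by
    unfold alphabetSize
    rw [← hκ, Nat.mul_succ, ← add_assoc, pow_add 2 _ (β + 2), pow_add 2 β 2, hB]
    ring
  rw [hB, h6]
  have : 4 * B * 2 ^ (4 * β * D + (β + 2) * k) = 2 * B * 2 ^ (4 * β * D + (β + 2) * k)
    + 2 * B * 2 ^ (4 * β * D + (β + 2) * k) := by ring
  omega

theorem alphabetSize_le {β D k : ℕ} (hβ : 2 ≤ β) (hk : k ≤ D) :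
    alphabetSize β D k ≤ 2 ^ (6 * β * D + 1) := by
  have h1 : (β + 2) * k ≤ 2 * β * D := Nat.mul_le_mul (by omega) hk
  have : 2 ^ (4 * β * D + (β + 2) * k) ≤ 2 ^ (6 * β * D) :=
    Nat.pow_le_pow_right (by norm_num) (by nlinarith)
  rw [alphabetSize, pow_succ]
  omega

/-- A labelling of the letters of all levels, and a decoder: any `2 ^ β` letters of level `k` are
encoded by one letter of level `k + 1`, labelled with the sum of their labels, and a number of
`(2 ^ β - 1) * (6 * β * D)` bits. -/
theorem exists_tree_code (β D : ℕ) (hβ : 2 ≤ β) :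
    ∃ (lab : ℕ → ℕ → ℕ) (dec : ℕ → ℕ → ℕ → ℕ → ℕ),
      (∀ z < alphabetSize β D 0, lab 0 z = z / 2 ^ (4 * β * D)) ∧
      ∀ k < D, ∀ c : ℕ → ℕ, (∀ j < 2 ^ β, c j < alphabetSize β D k) →
        ∃ z μ, z < alphabetSize β D (k + 1) ∧ μ < 2 ^ ((2 ^ β - 1) * (6 * β * D)) ∧
          lab (k + 1) z = ∑ j ∈ Finset.range (2 ^ β), lab k (c j) ∧
          ∀ j < 2 ^ β, dec k z μ j = c j := by
  -- The hypotheses stand under the existential quantifier so that `choose` gives total functions,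
  -- by which labels can be defined recursively.
  have step : ∀ (k : ℕ) (lab : ℕ → ℕ), ∃ (lab' : ℕ → ℕ) (dec : ℕ → ℕ → ℕ → ℕ),
      k < D → (∀ z, lab z ≤ 2 ^ (2 * β * D) * (2 ^ β) ^ k) →
      (∀ z, lab' z ≤ 2 ^ (2 * β * D) * (2 ^ β) ^ (k + 1)) ∧
      ∀ c : ℕ → ℕ, (∀ j < 2 ^ β, c j < alphabetSize β D k) →
        ∃ z μ, z < alphabetSize β D (k + 1) ∧ μ < 2 ^ ((2 ^ β - 1) * (6 * β * D)) ∧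
          lab' z = ∑ j ∈ Finset.range (2 ^ β), lab (c j) ∧
          ∀ j < 2 ^ β, dec z μ j = c j := by
    intro k lab
    by_cases h : k < D ∧ ∀ z, lab z ≤ 2 ^ (2 * β * D) * (2 ^ β) ^ k
    · obtain ⟨lab', dec, h1, h2⟩ := exists_tuple_code (2 ^ β) _ _ _ _ lab h.2
        (by positivity) (alphabetSize_step hβ h.1)
      refine ⟨lab', dec, fun _ _ => ⟨fun z => (h1 z).trans_eq (by ring), h2⟩⟩
    · exact ⟨fun _ => 0, fun _ _ _ => 0, fun h1 h2 => (h ⟨h1, h2⟩).elim⟩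
  choose nextLab nextDec hnext using step
  -- The cap 2^(2βD) bounds the labels of all numbers; it is not felt below `alphabetSize β D 0`.
  let lab : ℕ → ℕ → ℕ := fun k => Nat.rec
    (fun z => min (z / 2 ^ (4 * β * D)) (2 ^ (2 * β * D))) (fun k l => nextLab k l) k
  have hlab : ∀ k ≤ D, ∀ z, lab k z ≤ 2 ^ (2 * β * D) * (2 ^ β) ^ k := by
    intro k
    induction k with
    | zero => intro _ z; simp [lab]
    | succ k ih => intro hk; exact (hnext k (lab k) hk (ih (by omega))).1
  refine ⟨lab, fun k => nextDec k (lab k), ?_, fun k hk => (hnext k (lab k) hk (hlab k hk.le)).2⟩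
  intro z hz
  have h1 : z < (2 ^ (2 * β * D) + 1) * 2 ^ (4 * β * D) := by
    convert hz using 1
    rw [alphabetSize, mul_zero, add_zero, add_mul, ← pow_add, one_mul]
    congr 2
    ring
  have := (Nat.div_lt_iff_lt_mul (by positivity)).2 h1
  exact min_eq_left (by omega)

/-! ### The query program -/

namespace WordRAM

theorem runRegs_append {w m : ℕ} (M : Fin m → BitVec w) (l l' : List Instr) (R : ℕ → BitVec w) :
    runRegs M (l ++ l') R = runRegs M l' (runRegs M l R) := by
  induction l generalizing R with
  | nil => rfl
  | cons I l ih => exact ih _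

/-- Copy the words `0, …, k - 1` of the memory to the registers `1, …, k`. -/
def loadHeader : ℕ → List Instr
  | 0 => []
  | k + 1 => loadHeader k ++ [.const (k + 1) k, .load (k + 1) (k + 1)]

/-- Find the block of the queried index, its base value and its topmost letter. -/
def queryInit : List Instr :=
  loadHeader 17 ++ [.const 18 1, .op .sub 0 0 18, .op .div 22 0 2, .op .add 20 9 22, .load 20 20,
    .op .add 21 10 22, .load 21 21]

/-- Descend by one level of the tree. -/
def queryBody : List Instr :=
  [.op .sub 8 8 7, .op .div 2 2 3, .op .mul 23 22 5] ++ (readField 13 6 ++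
  [.op .div 23 0 2, .op .mod 23 23 3, .op .add 24 8 21, .op .mul 24 24 6, .op .add 24 24 26,
    .op .mul 24 24 3, .op .add 24 24 23, .op .add 25 24 12, .load 25 25, .op .add 20 20 25,
    .op .add 24 24 11, .load 21 24, .op .mul 22 22 3, .op .add 22 22 4, .op .add 22 22 23])

/-- Combine the values found with the low bits of the answer. -/
def queryFinish : List Instr :=
  [.op .mul 23 0 15] ++ (readField 14 16 ++
  [.op .mul 20 20 17, .op .mul 21 21 16, .op .add 0 20 21, .op .add 0 0 26])

/-- The query program. -/
def queryProgram : Program :=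
  -- The initial part occupies positions 0 to 40, the loop 41 to 71, and the final part starts at
  -- 72. Register 19 is always 0, and comparing it with itself gives an unconditional jump.
  queryInit ++ ([.jeq 8 19 72] ++ (queryBody ++ ([.jeq 19 19 41] ++ queryFinish)))

/-- The numbers in the header of the memory. -/
structure Params where
  /-- word size -/
  w : ℕ
  /-- branching factor of the trees -/
  B : ℕ
  /-- depth of the trees -/
  D : ℕ
  /-- number of trees -/
  G : ℕ
  /-- number of bits stored at a node -/
  nodeBits : ℕ
  /-- bound for the letters -/
  Z : ℕ
  /-- address of the base values of the trees -/
  aBase : ℕ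
  /-- address of the letters of the roots -/
  aTop : ℕ
  /-- address of the table of letters of children -/
  aLetter : ℕ
  /-- address of the table of sums of labels -/
  aSum : ℕ
  /-- address of the bits of the nodes -/
  aNode : ℕ
  /-- address of the low bits -/
  aLow : ℕ
  /-- number of low bits -/
  p : ℕ
  /-- the unit of the labels -/
  E : ℕ

/-- The header of the memory. -/
def Params.header (Q : Params) : List ℕ :=
  [Q.w, Q.B ^ Q.D, Q.B, Q.G, Q.nodeBits, 2 ^ Q.nodeBits, Q.Z, Q.D * Q.Z, Q.aBase, Q.aTop,
    Q.aLetter, Q.aSum, Q.aNode, Q.aLow, Q.p, 2 ^ Q.p, Q.E]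

/-- The registers `0, …, 22` when the query for index `x` has come to level `k`. -/
def Params.regs (Q : Params) (x k acc z id : ℕ) : List ℕ :=
  [x, Q.w, Q.B ^ k, Q.B, Q.G, Q.nodeBits, 2 ^ Q.nodeBits, Q.Z, k * Q.Z, Q.aBase, Q.aTop,
    Q.aLetter, Q.aSum, Q.aNode, Q.aLow, Q.p, 2 ^ Q.p, Q.E, 1, 0, acc, z, id]

/-- The word at an address. -/
def ReadsAt {w m : ℕ} (M : Fin m → BitVec w) (a y : ℕ) : Prop :=
  readWord M (BitVec.ofNat w a) = BitVec.ofNat w y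

/-- The two words that contain the bits from position `pos` on of the number `V`, stored from
address `a` on. -/
def ReadsBits {w m : ℕ} (M : Fin m → BitVec w) (a V pos : ℕ) : Prop :=
  pos < 2 ^ w ∧ ReadsAt M (a + pos / w) (V / 2 ^ (w * (pos / w)) % 2 ^ w) ∧
    ReadsAt M (a + (pos / w + 1)) (V / 2 ^ (w * (pos / w + 1)) % 2 ^ w)

/-- The registers below `23` hold the numbers in a list. -/
def RegsAre {w : ℕ} (R : ℕ → BitVec w) (l : List ℕ) : Prop :=
  ∀ r < 23, R r = BitVec.ofNat w (l.getD r 0)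

/-! ### Execution of the query program -/

theorem runRegs_loadHeader {w m : ℕ} (M : Fin m → BitVec w) (R : ℕ → BitVec w) (l : List ℕ)
    (k : ℕ) (h : ∀ i < k, ReadsAt M i (l.getD i 0)) :
    (∀ i < k, runRegs M (loadHeader k) R (i + 1) = BitVec.ofNat w (l.getD i 0)) ∧
      ∀ r, r = 0 ∨ k < r → runRegs M (loadHeader k) R r = R r := by
  induction k with
  | zero => exact ⟨by simp, fun _ _ => rfl⟩
  | succ k ih =>
    obtain ⟨h1, h2⟩ := ih fun i hi => h i (by omega)
    rw [loadHeader, runRegs_append]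
    simp only [runRegs, exec, Function.update_apply]
    refine ⟨fun i hi => ?_, fun r hr => ?_⟩
    · by_cases hik : i = k
      · subst hik
        simpa [ReadsAt] using h i (by omega)
      · simp only [show i + 1 ≠ k + 1 by omega, if_false]
        exact h1 i (by omega)
    · simp only [show r ≠ k + 1 by omega, if_false]
      exact h2 r (by omega)

theorem runRegs_queryInit {w m : ℕ} (M : Fin m → BitVec w) (Q : Params) (x acc z : ℕ)
    (hx : x + 1 < 2 ^ w) (hN : Q.B ^ Q.D < 2 ^ w)
    (hH : ∀ i < 17, ReadsAt M i (Q.header.getD i 0))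
    (hbase : ReadsAt M (Q.aBase + x / Q.B ^ Q.D) acc)
    (htop : ReadsAt M (Q.aTop + x / Q.B ^ Q.D) z) :
    RegsAre (runRegs M queryInit (start (BitVec.ofNat w (x + 1))).reg)
      (Q.regs x Q.D acc z (x / Q.B ^ Q.D)) := by
  obtain ⟨h1, h2⟩ := runRegs_loadHeader M (start (BitVec.ofNat w (x + 1))).reg Q.header 17 hH
  rw [queryInit, runRegs_append]
  generalize runRegs M (loadHeader 17) (start (BitVec.ofNat w (x + 1))).reg = R at h1 h2
  have e0 : R 0 = BitVec.ofNat w (x + 1) := h2 0 (Or.inl rfl)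
  have e2 : R 2 = BitVec.ofNat w (Q.B ^ Q.D) := h1 1 (by norm_num)
  have e9 : R 9 = BitVec.ofNat w Q.aBase := h1 8 (by norm_num)
  have e10 : R 10 = BitVec.ofNat w Q.aTop := h1 9 (by norm_num)
  have e19 : R 19 = BitVec.ofNat w 0 := h2 19 (Or.inr (by norm_num))
  unfold ReadsAt at hbase htop
  intro r hr
  simp only [runRegs, exec, BinOp.eval, Function.update_apply, reduceIte, Nat.reduceEqDiff, e0, e2,
    e9, e10, ofNat_sub_ofNat (Nat.le_add_left 1 x), Nat.add_sub_cancel,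
    ofNat_div_ofNat (show x < 2 ^ w by omega) hN, ← BitVec.ofNat_add, hbase, htop]
  interval_cases r <;> simp only [reduceIte, Nat.reduceEqDiff] <;>
    first
    | rfl
    | exact e19
    | exact h1 0 (by norm_num)
    | exact h1 1 (by norm_num)
    | exact h1 2 (by norm_num)
    | exact h1 3 (by norm_num)
    | exact h1 4 (by norm_num)
    | exact h1 5 (by norm_num)
    | exact h1 6 (by norm_num)
    | exact h1 7 (by norm_num)
    | exact h1 8 (by norm_num)
    | exact h1 9 (by norm_num)
    | exact h1 10 (by norm_num)
    | exact h1 11 (by norm_num)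
    | exact h1 12 (by norm_num)
    | exact h1 13 (by norm_num)
    | exact h1 14 (by norm_num)
    | exact h1 15 (by norm_num)
    | exact h1 16 (by norm_num)

/-- This preserves the loop invariant `Params.regs`. Register 8 holds k·Z, which serves both as the
loop counter and as the offset of level k in the tables. -/
theorem runRegs_queryBody {w m : ℕ} (M : Fin m → BitVec w) (Q : Params) (hQw : Q.w = w)
    (R : ℕ → BitVec w) {x k acc z id μ z' σ j V : ℕ} (hw : 0 < w) (hf : Q.nodeBits < w)
    (hB : 0 < Q.B) (hBk : Q.B ^ (k + 1) < 2 ^ w) (hx : x < 2 ^ w)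
    (hR : RegsAre R (Q.regs x (k + 1) acc z id))
    (hV : ReadsBits M Q.aNode V (id * Q.nodeBits))
    (hμ : V / 2 ^ (id * Q.nodeBits) % 2 ^ Q.nodeBits = μ) (hj : x / Q.B ^ k % Q.B = j)
    (hz : ReadsAt M (Q.aLetter + (((k * Q.Z + z) * 2 ^ Q.nodeBits + μ) * Q.B + j)) z')
    (hσ : ReadsAt M (Q.aSum + (((k * Q.Z + z) * 2 ^ Q.nodeBits + μ) * Q.B + j)) σ) :
    RegsAre (runRegs M queryBody R) (Q.regs x k (acc + σ) z' (id * Q.B + Q.G + j)) := by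
  have hBk' : Q.B ^ k < 2 ^ w := (Nat.pow_le_pow_right hB (Nat.le_succ k)).trans_lt hBk
  have hB' : Q.B < 2 ^ w := (Nat.le_self_pow (by omega) Q.B).trans_lt hBk
  have e : ∀ r (hr : r < 23), R r = _ := hR
  rw [queryBody, runRegs_append, runRegs_append]
  set R₁ := runRegs M [.op .sub 8 8 7, .op .div 2 2 3, .op .mul 23 22 5] R with hR₁
  have a8 : R₁ 8 = BitVec.ofNat w (k * Q.Z) := by
    have e8 : R 8 = BitVec.ofNat w ((k + 1) * Q.Z) := e 8 (by norm_num)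
    have e7 : R 7 = BitVec.ofNat w Q.Z := e 7 (by norm_num)
    simp only [hR₁, runRegs, exec, BinOp.eval, Function.update_apply, reduceIte, Nat.reduceEqDiff,
      e8, e7]
    rw [ofNat_sub_ofNat (Nat.le_mul_of_pos_left _ (by omega)), Nat.add_mul, one_mul,
      Nat.add_sub_cancel]
  have a2 : R₁ 2 = BitVec.ofNat w (Q.B ^ k) := by
    have e2 : R 2 = BitVec.ofNat w (Q.B ^ (k + 1)) := e 2 (by norm_num)
    have e3 : R 3 = BitVec.ofNat w Q.B := e 3 (by norm_num)
    simp only [hR₁, runRegs, exec, BinOp.eval, Function.update_apply, reduceIte, Nat.reduceEqDiff,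
      e2, e3]
    rw [ofNat_div_ofNat hBk hB', pow_succ, Nat.mul_div_cancel _ hB]
  have a23 : R₁ 23 = BitVec.ofNat w (id * Q.nodeBits) := by
    have e22 : R 22 = BitVec.ofNat w id := e 22 (by norm_num)
    have e5 : R 5 = BitVec.ofNat w Q.nodeBits := e 5 (by norm_num)
    simp only [hR₁, runRegs, exec, BinOp.eval, Function.update_apply, reduceIte, Nat.reduceEqDiff,
      e22, e5, ← BitVec.ofNat_mul]
  have ar : ∀ r < 23, r ≠ 8 → r ≠ 2 → R₁ r = R r := by
    intro r hr h8 h2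
    simp only [hR₁, runRegs, exec, Function.update_apply, h8, h2, show r ≠ 23 by omega, if_false]
  have a (r : ℕ) (hr : r < 23) (h8 : r ≠ 8) (h2 : r ≠ 2) := (ar r hr h8 h2).trans (e r hr)
  obtain ⟨b26, br⟩ := runRegs_readField M R₁ (base := 13) (modulus := 6) (a := Q.aNode)
    (f := Q.nodeBits) (pos := id * Q.nodeBits) (V := V) (by norm_num) (by norm_num) hw hf hV.1 a23
    ((a 1 (by norm_num) (by norm_num) (by norm_num)).trans (by rw [← hQw]; rfl))
    (a 18 (by norm_num) (by norm_num) (by norm_num))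
    (a 13 (by norm_num) (by norm_num) (by norm_num))
    (a 6 (by norm_num) (by norm_num) (by norm_num)) hV.2.1 hV.2.2
  rw [hμ] at b26
  set R₂ := runRegs M (readField 13 6) R₁
  clear_value R₁ R₂
  have b (r : ℕ) (hr : r < 23) (h8 : r ≠ 8) (h2 : r ≠ 2) :=
    (br r (by omega) (by omega) (by omega) (by omega)).trans (a r hr h8 h2)
  have b8 := (br 8 (by omega) (by omega) (by omega) (by omega)).trans a8
  have b2 := (br 2 (by omega) (by omega) (by omega) (by omega)).trans a2
  have b0 : R₂ 0 = BitVec.ofNat w x := b 0 (by omega) (by omega) (by omega)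
  have b3 : R₂ 3 = BitVec.ofNat w Q.B := b 3 (by omega) (by omega) (by omega)
  have b4 : R₂ 4 = BitVec.ofNat w Q.G := b 4 (by omega) (by omega) (by omega)
  have b6 : R₂ 6 = BitVec.ofNat w (2 ^ Q.nodeBits) := b 6 (by omega) (by omega) (by omega)
  have b11 : R₂ 11 = BitVec.ofNat w Q.aLetter := b 11 (by omega) (by omega) (by omega)
  have b12 : R₂ 12 = BitVec.ofNat w Q.aSum := b 12 (by omega) (by omega) (by omega)
  have b20 : R₂ 20 = BitVec.ofNat w acc := b 20 (by omega) (by omega) (by omega)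
  have b21 : R₂ 21 = BitVec.ofNat w z := b 21 (by omega) (by omega) (by omega)
  have b22 : R₂ 22 = BitVec.ofNat w id := b 22 (by omega) (by omega) (by omega)
  unfold ReadsAt at hz hσ
  rw [add_comm Q.aLetter] at hz
  rw [add_comm Q.aSum] at hσ
  intro r hr
  simp only [runRegs, exec, BinOp.eval, Function.update_apply, reduceIte, Nat.reduceEqDiff, b0, b2,
    b3, b4, b6, b8, b11, b12, b20, b21, b22, b26, ofNat_div_ofNat hx hBk',
    ofNat_mod_ofNat (show x / Q.B ^ k < 2 ^ w from (Nat.div_le_self _ _).trans_lt hx) hB',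
    hj, ← BitVec.ofNat_add, ← BitVec.ofNat_mul, hz, hσ]
  by_cases h20 : r = 20
  · subst h20; rfl
  by_cases h21 : r = 21
  · subst h21; rfl
  by_cases h22 : r = 22
  · subst h22; rfl
  by_cases h8 : r = 8
  · subst h8; exact b8
  by_cases h2 : r = 2
  · subst h2; exact b2
  simp only [h20, h21, h22, show r ≠ 23 by omega, show r ≠ 24 by omega, show r ≠ 25 by omega,
    if_false]
  rw [b r hr h8 h2]
  interval_cases r <;> first | rfl | omega

theorem runRegs_queryFinish {w m : ℕ} (M : Fin m → BitVec w) (Q : Params) (hQw : Q.w = w)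
    (R : ℕ → BitVec w) {x acc z id V : ℕ} (hw : 0 < w) (hp : Q.p < w)
    (hR : RegsAre R (Q.regs x 0 acc z id)) (hV : ReadsBits M Q.aLow V (x * Q.p)) :
    runRegs M queryFinish R 0 =
      BitVec.ofNat w (acc * Q.E + z * 2 ^ Q.p + V / 2 ^ (x * Q.p) % 2 ^ Q.p) := by
  have e : ∀ r (hr : r < 23), R r = _ := hR
  rw [queryFinish, runRegs_append, runRegs_append]
  set R₁ := runRegs M [.op .mul 23 0 15] R with hR₁
  have a23 : R₁ 23 = BitVec.ofNat w (x * Q.p) := by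
    have e0 : R 0 = BitVec.ofNat w x := e 0 (by norm_num)
    have e15 : R 15 = BitVec.ofNat w Q.p := e 15 (by norm_num)
    simp only [hR₁, runRegs, exec, BinOp.eval, Function.update_apply, reduceIte,
      e0, e15, ← BitVec.ofNat_mul]
  have a : ∀ r (hr : r < 23), R₁ r = _ := fun r hr => Eq.trans (by
    simp only [hR₁, runRegs, exec, Function.update_apply, show r ≠ 23 by omega, if_false]) (e r hr)
  obtain ⟨b26, br⟩ := runRegs_readField M R₁ (base := 14) (modulus := 16) (a := Q.aLow)
    (f := Q.p) (pos := x * Q.p) (V := V) (by norm_num) (by norm_num) hw hp hV.1 a23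
    ((a 1 (by norm_num)).trans (by rw [← hQw]; rfl)) (a 18 (by norm_num)) (a 14 (by norm_num))
    (a 16 (by norm_num)) hV.2.1 hV.2.2
  set R₂ := runRegs M (readField 14 16) R₁
  clear_value R₁ R₂
  have b (r : ℕ) (hr : r < 23) := (br r (by omega) (by omega) (by omega) (by omega)).trans (a r hr)
  have b16 : R₂ 16 = BitVec.ofNat w (2 ^ Q.p) := b 16 (by omega)
  have b17 : R₂ 17 = BitVec.ofNat w Q.E := b 17 (by omega)
  have b20 : R₂ 20 = BitVec.ofNat w acc := b 20 (by omega)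
  have b21 : R₂ 21 = BitVec.ofNat w z := b 21 (by omega)
  simp only [runRegs, exec, BinOp.eval, Function.update_apply, reduceIte, Nat.reduceEqDiff, b16,
    b17, b20, b21, b26, ← BitVec.ofNat_add, ← BitVec.ofNat_mul]

/-- One round of the loop: the test, the descent and the jump back. -/
theorem iterate_step_queryLoop {w m : ℕ} (M : Fin m → BitVec w) (R : ℕ → BitVec w)
    (h8 : R 8 ≠ R 19) :
    (step queryProgram M)^[31] ⟨41, R⟩ = ⟨41, runRegs M queryBody R⟩ := by
  rw [show 31 = 1 + (queryBody.length + 1) from rfl, Function.iterate_add_apply,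
    Function.iterate_add_apply, Function.iterate_one]
  have h1 : step queryProgram M ⟨41, R⟩ = ⟨42, R⟩ := by
    change exec M ⟨41, R⟩ (.jeq 8 19 72) = _
    simp [exec, h8]
  rw [h1, iterate_step_straight M queryProgram queryBody ([.jeq 19 19 41] ++ queryFinish)
    (by simp [queryBody, readField, Instr.IsStraight]) 42 rfl R]
  change exec M ⟨71, _⟩ (.jeq 19 19 41) = _
  simp [exec]

/-- The query program returns what it finds on its way down to a leaf of a tree. -/
theorem queryProgram_returns {w m : ℕ} (M : Fin m → BitVec w) (Q : Params) (hQw : Q.w = w)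
    (hw : 0 < w) (hf : Q.nodeBits < w) (hp : Q.p < w) (hB : 0 < Q.B) (hN : Q.B ^ Q.D < 2 ^ w)
    (hZ : 0 < Q.Z) (hDZ : Q.D * Q.Z < 2 ^ w)
    (x : ℕ) (hx : x + 1 < 2 ^ w) (acc z id σ : ℕ → ℕ) (V V' : ℕ)
    (hH : ∀ i < 17, ReadsAt M i (Q.header.getD i 0))
    (hbase : ReadsAt M (Q.aBase + x / Q.B ^ Q.D) (acc Q.D))
    (htop : ReadsAt M (Q.aTop + x / Q.B ^ Q.D) (z Q.D))
    (hid : id Q.D = x / Q.B ^ Q.D)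
    (hid' : ∀ k < Q.D, id k = id (k + 1) * Q.B + Q.G + x / Q.B ^ k % Q.B)
    (hV : ∀ k < Q.D, ReadsBits M Q.aNode V (id (k + 1) * Q.nodeBits))
    (hz : ∀ k < Q.D, ReadsAt M (Q.aLetter + (((k * Q.Z + z (k + 1)) * 2 ^ Q.nodeBits +
      V / 2 ^ (id (k + 1) * Q.nodeBits) % 2 ^ Q.nodeBits) * Q.B + x / Q.B ^ k % Q.B)) (z k))
    (hσ : ∀ k < Q.D, ReadsAt M (Q.aSum + (((k * Q.Z + z (k + 1)) * 2 ^ Q.nodeBits +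
      V / 2 ^ (id (k + 1) * Q.nodeBits) % 2 ^ Q.nodeBits) * Q.B + x / Q.B ^ k % Q.B)) (σ k))
    (hacc : ∀ k < Q.D, acc k = acc (k + 1) + σ k)
    (hV' : ReadsBits M Q.aLow V' (x * Q.p)) {T : ℝ} (hT : 58 + 31 * (Q.D : ℝ) ≤ T) {y : ℕ}
    (hy : acc 0 * Q.E + z 0 * 2 ^ Q.p + V' / 2 ^ (x * Q.p) % 2 ^ Q.p = y) (hyw : y < 2 ^ w) :
    ReturnsWithin queryProgram M (BitVec.ofNat w (x + 1)) T y := by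
  have hinit : (step queryProgram M)^[41] (start (BitVec.ofNat w (x + 1))) =
      ⟨41, runRegs M queryInit (start (BitVec.ofNat w (x + 1))).reg⟩ :=
    iterate_step_straight M queryProgram queryInit _
      (by simp [queryInit, loadHeader, Instr.IsStraight]) 0 rfl _
  have hloop : ∀ e ≤ Q.D, ∃ R : ℕ → BitVec w,
      (step queryProgram M)^[31 * e + 41] (start (BitVec.ofNat w (x + 1))) = ⟨41, R⟩ ∧
      RegsAre R (Q.regs x (Q.D - e) (acc (Q.D - e)) (z (Q.D - e)) (id (Q.D - e))) := by
    intro e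
    induction e with
    | zero =>
      intro _
      refine ⟨_, hinit, ?_⟩
      rw [Nat.sub_zero, hid]
      exact runRegs_queryInit M Q x _ _ hx hN hH hbase htop
    | succ e ih =>
      intro he
      obtain ⟨R, h1, h2⟩ := ih (by omega)
      obtain ⟨k, hk⟩ : ∃ k, Q.D - e = k + 1 := ⟨Q.D - e - 1, by omega⟩
      rw [hk] at h2
      rw [show Q.D - (e + 1) = k by omega]
      have hkD : k < Q.D := by omega
      refine ⟨runRegs M queryBody R, ?_, ?_⟩
      · rw [show 31 * (e + 1) + 41 = 31 + (31 * e + 41) by ring, Function.iterate_add_apply, h1]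
        apply iterate_step_queryLoop
        have e8 : R 8 = BitVec.ofNat w ((k + 1) * Q.Z) := h2 8 (by norm_num)
        have e19 : R 19 = BitVec.ofNat w 0 := h2 19 (by norm_num)
        rw [e8, e19]
        -- The loop must not stop early: the counter (k+1)·Z is positive and, by `hDZ`, does not
        -- wrap around to 0.
        intro h
        have h3 := congrArg BitVec.toNat h
        have h4 : (k + 1) * Q.Z ≤ Q.D * Q.Z := Nat.mul_le_mul_right _ hkD
        have h5 : 0 < (k + 1) * Q.Z := by positivity
        rw [BitVec.toNat_ofNat, BitVec.toNat_ofNat, Nat.mod_eq_of_lt (by omega),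
          Nat.zero_mod] at h3
        omega
      · rw [hacc k hkD, hid' k hkD]
        exact runRegs_queryBody M Q hQw R hw hf hB
          ((Nat.pow_le_pow_right hB hkD).trans_lt hN) (by omega) h2 (hV k hkD) rfl rfl
          (hz k hkD) (hσ k hkD)
  obtain ⟨R, h1, h2⟩ := hloop Q.D le_rfl
  rw [Nat.sub_self] at h2
  have hexit : step queryProgram M ⟨41, R⟩ = ⟨72, R⟩ := by
    change exec M ⟨41, R⟩ (.jeq 8 19 72) = _
    have e8 : R 8 = BitVec.ofNat w (0 * Q.Z) := h2 8 (by norm_num)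
    have e19 : R 19 = BitVec.ofNat w 0 := h2 19 (by norm_num)
    simp [exec, e8, e19]
  have hend := iterate_step_straight M queryProgram queryFinish []
    (by simp [queryFinish, readField, Instr.IsStraight]) 72 rfl R
  -- 41 initial steps, 31 per level, the exit jump and 16 final steps: 58 + 31D in all.
  have hfin : (step queryProgram M)^[16 + (1 + (31 * Q.D + 41))]
      (start (BitVec.ofNat w (x + 1))) = ⟨88, runRegs M queryFinish R⟩ := by
    rw [Function.iterate_add_apply, Function.iterate_add_apply, h1, Function.iterate_one, hexit]
    exact hend
  refine ⟨16 + (1 + (31 * Q.D + 41)), ?_, ?_⟩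
  · push_cast; linarith
  · rw [hfin]
    refine ⟨le_refl 88, ?_⟩
    change (runRegs M queryFinish R 0).toNat = y
    rw [runRegs_queryFinish M Q hQw R hw hp h2 hV', hy, BitVec.toNat_ofNat,
      Nat.mod_eq_of_lt hyw]

end WordRAM

/-! ### The trees over a sequence of letters -/

/-- Letters and numbers at all nodes of the trees whose leaves carry given letters. -/
theorem exists_tree_encoding {B D m : ℕ} (K : ℕ → ℕ) (lab : ℕ → ℕ → ℕ)
    (dec : ℕ → ℕ → ℕ → ℕ → ℕ)
    (hcode : ∀ k < D, ∀ c : ℕ → ℕ, (∀ j < B, c j < K k) → ∃ z μ, z < K (k + 1) ∧ μ < m ∧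
      lab (k + 1) z = ∑ j ∈ Finset.range B, lab k (c j) ∧ ∀ j < B, dec k z μ j = c j)
    (x : ℕ → ℕ) (hx : ∀ i, x i < K 0) :
    ∃ z μ : ℕ → ℕ → ℕ, z 0 = x ∧ (∀ k ≤ D, ∀ u, z k u < K k) ∧
      ∀ k < D, ∀ u, μ k u < m ∧
        lab (k + 1) (z (k + 1) u) = ∑ j ∈ Finset.range B, lab k (z k (u * B + j)) ∧
        ∀ j < B, dec k (z (k + 1) u) (μ k u) j = z k (u * B + j) := by
  have step : ∀ (k : ℕ) (c : ℕ → ℕ), ∃ (z μ : ℕ), k < D → (∀ j < B, c j < K k) →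
      z < K (k + 1) ∧ μ < m ∧ lab (k + 1) z = ∑ j ∈ Finset.range B, lab k (c j) ∧
        ∀ j < B, dec k z μ j = c j := by
    intro k c
    by_cases h : k < D ∧ ∀ j < B, c j < K k
    · obtain ⟨z, μ, h1⟩ := hcode k h.1 c h.2
      exact ⟨z, μ, fun _ _ => h1⟩
    · exact ⟨0, 0, fun h1 h2 => (h ⟨h1, h2⟩).elim⟩
  choose up field hup using step
  let z : ℕ → ℕ → ℕ := fun k => Nat.rec x (fun k y u => up k fun j => y (u * B + j)) k
  have hz : ∀ k ≤ D, ∀ u, z k u < K k := by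
    intro k
    induction k with
    | zero => exact fun _ => hx
    | succ k ih => exact fun hk u => (hup k _ hk fun j _ => ih (by omega) _).1
  refine ⟨z, fun k u => field k fun j => z k (u * B + j), rfl, hz, fun k hk u => ?_⟩
  exact (hup k _ hk fun j _ => hz k hk.le _).2

/-- The number of nodes in the top `e` levels of `G` trees of branching factor `B`. -/
def heapStart (B G : ℕ) : ℕ → ℕ
  | 0 => 0
  | e + 1 => heapStart B G e * B + G

/-- The recursion in `heapStart` fits the numbering in which child j of node i has number i·B + G +
j; here it is seen to count nodes level by level. -/
theorem heapStart_succ (B G e : ℕ) : heapStart B G (e + 1) = heapStart B G e + G * B ^ e := by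
  induction e with
  | zero => simp [heapStart]
  | succ e ih =>
    rw [heapStart, ih, add_mul, pow_succ]
    rw [heapStart] at ih
    linarith

theorem heapStart_mul (B G e : ℕ) : heapStart B G e * B + G = heapStart B G e + G * B ^ e :=
  heapStart_succ B G e

theorem heapStart_add_lt {B G e D u : ℕ} (he : e < D) (hu : u < G * B ^ e) :
    heapStart B G e + u < heapStart B G D := by
  have h : Monotone (heapStart B G) :=
    monotone_nat_of_le_succ fun e => by rw [heapStart_succ]; omega
  have h1 := h (Nat.succ_le_of_lt he)
  rw [Nat.succ_eq_add_one, heapStart_succ] at h1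
  omega

theorem exists_heap_array {B G m : ℕ} (D : ℕ) (g : ℕ → ℕ → ℕ) (hm : 0 < m)
    (hg : ∀ e < D, ∀ u, g e u < m) :
    ∃ f : ℕ → ℕ, (∀ i, f i < m) ∧ ∀ e < D, ∀ u < G * B ^ e, f (heapStart B G e + u) = g e u := by
  induction D with
  | zero => exact ⟨fun _ => 0, fun _ => hm, by simp⟩
  | succ D ih =>
    obtain ⟨f, h1, h2⟩ := ih fun e he => hg e (by omega)
    refine ⟨fun i => if i < heapStart B G D then f i else g D (i - heapStart B G D), ?_, ?_⟩
    · intro i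
      dsimp only
      split_ifs
      · exact h1 i
      · exact hg D (by omega) _
    · intro e he u hu
      rcases Nat.lt_succ_iff_lt_or_eq.1 he with h | rfl
      · simp only [heapStart_add_lt h hu, if_true]
        exact h2 e h u hu
      · simp

/-! ### The memory -/

namespace WordRAM

/-- The header for sequences of `n` numbers of `ℓ` bits, with trees of branching factor `2 ^ β` and
depth `D`. -/
def layout (n ℓ w β D : ℕ) : Params where
  w := w
  B := 2 ^ β
  D := D
  G := n / (2 ^ β) ^ D + 1
  nodeBits := (2 ^ β - 1) * (6 * β * D)
  Z := 2 ^ (6 * β * D + 1)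
  aBase := 17
  aTop := 17 + (n / (2 ^ β) ^ D + 1)
  aLetter := 17 + 2 * (n / (2 ^ β) ^ D + 1)
  aSum := 17 + 2 * (n / (2 ^ β) ^ D + 1) +
    D * 2 ^ (6 * β * D + 1) * 2 ^ ((2 ^ β - 1) * (6 * β * D)) * 2 ^ β
  aNode := 17 + 2 * (n / (2 ^ β) ^ D + 1) +
    2 * (D * 2 ^ (6 * β * D + 1) * 2 ^ ((2 ^ β - 1) * (6 * β * D)) * 2 ^ β)
  aLow := 17 + 2 * (n / (2 ^ β) ^ D + 1) +
    2 * (D * 2 ^ (6 * β * D + 1) * 2 ^ ((2 ^ β - 1) * (6 * β * D)) * 2 ^ β) +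
    (heapStart (2 ^ β) (n / (2 ^ β) ^ D + 1) D * ((2 ^ β - 1) * (6 * β * D)) / w + 2)
  p := ℓ - 6 * β * D
  E := 2 ^ (ℓ - 2 * β * D)

/-- The number of entries of a lookup table. -/
def Params.tableSize (Q : Params) : ℕ := Q.D * Q.Z * 2 ^ Q.nodeBits * Q.B

/-- The number of words for the bits of the nodes. -/
def Params.nodeWords (Q : Params) : ℕ := heapStart Q.B Q.G Q.D * Q.nodeBits / Q.w + 2

/-- The number of words for the low bits. -/
def Params.lowWords (Q : Params) : ℕ := Q.G * Q.B ^ Q.D * Q.p / Q.w + 2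

/-- The number of words of the memory. -/
def Params.size (Q : Params) : ℕ :=
  17 + 2 * Q.G + 2 * Q.tableSize + Q.nodeWords + Q.lowWords

/-- The contents of the memory, put together from its segments. -/
def Params.memory (Q : Params) (base top letter sum : ℕ → ℕ) (V V' : ℕ) (i : ℕ) : ℕ :=
  if i < 17 then Q.header.getD i 0
  else if i < Q.aTop then base (i - Q.aBase)
  else if i < Q.aLetter then top (i - Q.aTop)
  else if i < Q.aSum then letter (i - Q.aLetter)
  else if i < Q.aNode then sum (i - Q.aSum)
  else if i < Q.aLow then V / 2 ^ (Q.w * (i - Q.aNode)) % 2 ^ Q.w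
  else V' / 2 ^ (Q.w * (i - Q.aLow)) % 2 ^ Q.w

/-- The inner nodes, times B-1, plus the roots make the number of leaves. Hence the node bits come
to κ per leaf less κ per tree, and with the ℓ-κ low bits no leaf takes more than ℓ bits. The 21
words are the header and two spare words for each of the two bit arrays. -/
theorem layout_size_mul_le {n ℓ w β D : ℕ} (hκ : 6 * β * D ≤ ℓ) :
    (layout n ℓ w β D).size * w ≤
      (layout n ℓ w β D).G * ((2 ^ β) ^ D) * ℓ + 2 * (layout n ℓ w β D).G * w +
        2 * (layout n ℓ w β D).tableSize * w + 21 * w := by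
  set Q := layout n ℓ w β D with hQ
  have hw : Q.w = w := rfl
  have hp : Q.p + 6 * β * D = ℓ := Nat.sub_add_cancel hκ
  have hB : Q.B = 2 ^ β := rfl
  have hD : Q.D = D := rfl
  have h1 : heapStart Q.B Q.G Q.D * Q.nodeBits + Q.G * (6 * β * D) =
      Q.G * Q.B ^ Q.D * (6 * β * D) := by
    have h := heapStart_mul Q.B Q.G Q.D
    have hB1 : 1 ≤ Q.B := Nat.one_le_two_pow
    obtain ⟨b, hb⟩ : ∃ b, Q.B = b + 1 := ⟨Q.B - 1, by omega⟩
    have hnb : Q.nodeBits = b * (6 * β * D) := by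
      change (Q.B - 1) * (6 * β * D) = _
      rw [hb, Nat.add_sub_cancel]
    have h' : heapStart Q.B Q.G Q.D * b + Q.G = Q.G * Q.B ^ Q.D := by
      have : heapStart Q.B Q.G Q.D * Q.B = heapStart Q.B Q.G Q.D * b + heapStart Q.B Q.G Q.D := by
        rw [← Nat.mul_succ, Nat.succ_eq_add_one, ← hb]
      omega
    rw [hnb, ← h']
    ring
  have h2 := Nat.div_mul_le_self (heapStart Q.B Q.G Q.D * Q.nodeBits) w
  have h3 := Nat.div_mul_le_self (Q.G * Q.B ^ Q.D * Q.p) w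
  have h4 : Q.G * Q.B ^ Q.D * ℓ = Q.G * Q.B ^ Q.D * Q.p + Q.G * Q.B ^ Q.D * (6 * β * D) := by
    rw [← hp]; ring
  rw [← hB, ← hD, h4]
  unfold Params.size Params.nodeWords Params.lowWords
  rw [hw]
  generalize heapStart Q.B Q.G Q.D * Q.nodeBits / w = a at h2 ⊢
  generalize Q.G * Q.B ^ Q.D * Q.p / w = b at h3 ⊢
  have := Nat.zero_le (Q.G * (6 * β * D))
  linarith

/-- The memory as words. -/
def Params.tape (Q : Params) (base top letter sum : ℕ → ℕ) (V V' : ℕ) : Fin Q.size → BitVec Q.w :=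
  fun i => BitVec.ofNat Q.w (Q.memory base top letter sum V V' i)

/-- The segments of the memory follow each other without gaps. -/
def Params.Consistent (Q : Params) : Prop :=
  Q.aBase = 17 ∧ Q.aTop = 17 + Q.G ∧ Q.aLetter = 17 + 2 * Q.G ∧
    Q.aSum = 17 + 2 * Q.G + Q.tableSize ∧ Q.aNode = 17 + 2 * Q.G + 2 * Q.tableSize ∧
    Q.aLow = 17 + 2 * Q.G + 2 * Q.tableSize + Q.nodeWords ∧
    Q.size = 17 + 2 * Q.G + 2 * Q.tableSize + Q.nodeWords + Q.lowWords

theorem layout_consistent (n ℓ w β D : ℕ) : (layout n ℓ w β D).Consistent :=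
  ⟨rfl, rfl, rfl, rfl, rfl, rfl, rfl⟩

section Memory

variable {Q : Params} (base top letter sum : ℕ → ℕ) (V V' : ℕ)

theorem tape_readsAt {i y : ℕ} (hm : Q.size ≤ 2 ^ Q.w)
    (hi : i < Q.size) (h : Q.memory base top letter sum V V' i = y) :
    ReadsAt (Q.tape base top letter sum V V') i y := by
  unfold ReadsAt Params.tape
  rw [readWord_ofNat _ hm hi, h]

theorem tape_reads_header (hQ : Q.Consistent) (hm : Q.size ≤ 2 ^ Q.w)
    {i : ℕ} (hi : i < 17) : ReadsAt (Q.tape base top letter sum V V') i (Q.header.getD i 0) := by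
  obtain ⟨h1, h2, h3, h4, h5, h6, h7⟩ := hQ
  refine tape_readsAt base top letter sum V V' hm (by omega) ?_
  rw [Params.memory, if_pos hi]

theorem tape_reads_base (hQ : Q.Consistent) (hm : Q.size ≤ 2 ^ Q.w)
    {g : ℕ} (hg : g < Q.G) : ReadsAt (Q.tape base top letter sum V V') (Q.aBase + g) (base g) := by
  obtain ⟨h1, h2, h3, h4, h5, h6, h7⟩ := hQ
  refine tape_readsAt base top letter sum V V' hm (by omega) ?_
  rw [Params.memory, if_neg (by omega), if_pos (by omega), Nat.add_sub_cancel_left]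

theorem tape_reads_top (hQ : Q.Consistent) (hm : Q.size ≤ 2 ^ Q.w)
    {g : ℕ} (hg : g < Q.G) : ReadsAt (Q.tape base top letter sum V V') (Q.aTop + g) (top g) := by
  obtain ⟨h1, h2, h3, h4, h5, h6, h7⟩ := hQ
  refine tape_readsAt base top letter sum V V' hm (by omega) ?_
  rw [Params.memory, if_neg (by omega), if_neg (by omega), if_pos (by omega),
    Nat.add_sub_cancel_left]

theorem tape_reads_letter (hQ : Q.Consistent) (hm : Q.size ≤ 2 ^ Q.w)
    {i : ℕ} (hi : i < Q.tableSize) :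
    ReadsAt (Q.tape base top letter sum V V') (Q.aLetter + i) (letter i) := by
  obtain ⟨h1, h2, h3, h4, h5, h6, h7⟩ := hQ
  refine tape_readsAt base top letter sum V V' hm (by omega) ?_
  rw [Params.memory, if_neg (by omega), if_neg (by omega), if_neg (by omega), if_pos (by omega),
    Nat.add_sub_cancel_left]

theorem tape_reads_sum (hQ : Q.Consistent) (hm : Q.size ≤ 2 ^ Q.w)
    {i : ℕ} (hi : i < Q.tableSize) :
    ReadsAt (Q.tape base top letter sum V V') (Q.aSum + i) (sum i) := by
  obtain ⟨h1, h2, h3, h4, h5, h6, h7⟩ := hQ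
  refine tape_readsAt base top letter sum V V' hm (by omega) ?_
  rw [Params.memory, if_neg (by omega), if_neg (by omega), if_neg (by omega), if_neg (by omega),
    if_pos (by omega), Nat.add_sub_cancel_left]

/-- The spare words in `nodeWords` keep both reads inside the segment, even for the last field;
`hmw` makes the bit position itself fit into a word. -/
theorem tape_readsBits_node (hQ : Q.Consistent) (hm : Q.size ≤ 2 ^ Q.w)
    {i : ℕ} (hw : 0 < Q.w) (hmw : Q.size * Q.w < 2 ^ Q.w)
    (hi : i < heapStart Q.B Q.G Q.D) :
    ReadsBits (Q.tape base top letter sum V V') Q.aNode V (i * Q.nodeBits) := by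
  obtain ⟨h1, h2, h3, h4, h5, h6, h7⟩ := hQ
  have h8 : i * Q.nodeBits ≤ heapStart Q.B Q.G Q.D * Q.nodeBits := Nat.mul_le_mul_right _ hi.le
  have h9 : i * Q.nodeBits / Q.w + 2 ≤ Q.nodeWords :=
    Nat.add_le_add_right (Nat.div_le_div_right h8) 2
  have h11 := Nat.lt_mul_div_succ (i * Q.nodeBits) hw
  unfold ReadsBits
  generalize i * Q.nodeBits = y at h9 h11 ⊢
  generalize y / Q.w = a at h9 h11 ⊢
  refine ⟨?_, ?_, ?_⟩
  · have h10 : a + 1 ≤ Q.size := by omega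
    have h12 := Nat.mul_le_mul_left Q.w h10
    rw [mul_comm Q.w Q.size] at h12
    omega
  · refine tape_readsAt base top letter sum V V' hm (by omega) ?_
    rw [Params.memory, if_neg (by omega), if_neg (by omega), if_neg (by omega), if_neg (by omega),
      if_neg (by omega), if_pos (by omega), Nat.add_sub_cancel_left]
  · refine tape_readsAt base top letter sum V V' hm (by omega) ?_
    rw [Params.memory, if_neg (by omega), if_neg (by omega), if_neg (by omega), if_neg (by omega),
      if_neg (by omega), if_pos (by omega), Nat.add_sub_cancel_left]

theorem tape_readsBits_low (hQ : Q.Consistent) (hm : Q.size ≤ 2 ^ Q.w)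
    {x : ℕ} (hw : 0 < Q.w) (hmw : Q.size * Q.w < 2 ^ Q.w)
    (hx : x < Q.G * Q.B ^ Q.D) :
    ReadsBits (Q.tape base top letter sum V V') Q.aLow V' (x * Q.p) := by
  obtain ⟨h1, h2, h3, h4, h5, h6, h7⟩ := hQ
  have h8 : x * Q.p ≤ Q.G * Q.B ^ Q.D * Q.p := Nat.mul_le_mul_right _ hx.le
  have h9 : x * Q.p / Q.w + 2 ≤ Q.lowWords := Nat.add_le_add_right (Nat.div_le_div_right h8) 2
  have h11 := Nat.lt_mul_div_succ (x * Q.p) hw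
  unfold ReadsBits
  generalize x * Q.p = y at h9 h11 ⊢
  generalize y / Q.w = a at h9 h11 ⊢
  refine ⟨?_, ?_, ?_⟩
  · have h10 : a + 1 ≤ Q.size := by omega
    have h12 := Nat.mul_le_mul_left Q.w h10
    rw [mul_comm Q.w Q.size] at h12
    omega
  · refine tape_readsAt base top letter sum V V' hm (by omega) ?_
    rw [Params.memory, if_neg (by omega), if_neg (by omega), if_neg (by omega), if_neg (by omega),
      if_neg (by omega), if_neg (by omega), Nat.add_sub_cancel_left]
  · refine tape_readsAt base top letter sum V V' hm (by omega) ?_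
    rw [Params.memory, if_neg (by omega), if_neg (by omega), if_neg (by omega), if_neg (by omega),
      if_neg (by omega), if_neg (by omega), Nat.add_sub_cancel_left]

end Memory

end WordRAM

/-! ### Correctness of the representation -/

namespace WordRAM

theorem mul_add_div_mod {a b c : ℕ} (h : c < b) : (a * b + c) / b = a ∧ (a * b + c) % b = c := by
  rw [mul_comm]
  exact ⟨by rw [Nat.mul_add_div (by omega), Nat.div_eq_of_lt h, add_zero],
    by rw [Nat.mul_add_mod, Nat.mod_eq_of_lt h]⟩

theorem mul_add_lt {a b c A : ℕ} (ha : a < A) (hc : c < b) : a * b + c < A * b := by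
  have h := Nat.mul_le_mul_right b (Nat.succ_le_of_lt ha)
  rw [Nat.succ_mul] at h
  omega

theorem sum_fin_filter_lt_eq {n : ℕ} (a : Fin n → ℕ) {i : ℕ} (hi : i ≤ n) :
    ∑ j : Fin n with j.val < i, a j =
      ∑ j ∈ Finset.range i, if h : j < n then a ⟨j, h⟩ else 0 := by
  rw [Finset.sum_filter]
  have h1 : ∀ j : Fin n, (if j.val < i then a j else 0) =
      (fun j : ℕ => if j < i then (if h : j < n then a ⟨j, h⟩ else 0) else 0) j := by
    intro j
    simp
  rw [Finset.sum_congr rfl fun j _ => h1 j,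
    Fin.sum_univ_eq_sum_range (fun j : ℕ => if j < i then (if h : j < n then a ⟨j, h⟩ else 0) else 0),
    ← Finset.sum_filter]
  congr 1
  ext j
  simp only [Finset.mem_filter, Finset.mem_range]
  omega

/-- Any sequence of `n` numbers of `ℓ` bits is represented by a memory with the given layout. -/
theorem exists_representation {n ℓ w β D : ℕ} (hβ : 2 ≤ β) (hD : 1 ≤ D)
    (hκ : 6 * β * D ≤ ℓ) (hℓw : ℓ < w) (hbits : (2 ^ β - 1) * (6 * β * D) < w)
    (hans : n * 2 ^ ℓ ≤ 2 ^ w) (hmw : (layout n ℓ w β D).size * w < 2 ^ w)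
    (a : Fin n → Fin (2 ^ ℓ)) {T : ℝ} (hT : 58 + 31 * (D : ℝ) ≤ T) :
    ∃ M : Fin (layout n ℓ w β D).size → BitVec w, AnswersPrefixSums queryProgram M a T := by
  obtain ⟨lab, dec, hlab0, hcode⟩ := exists_tree_code β D hβ
  have hcons := layout_consistent n ℓ w β D
  obtain ⟨Q, hQ⟩ : ∃ Q, Q = layout n ℓ w β D := ⟨_, rfl⟩
  have hQw : Q.w = w := by rw [hQ]; rfl
  have hQB : Q.B = 2 ^ β := by rw [hQ]; rfl
  have hQD : Q.D = D := by rw [hQ]; rfl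
  have hQG : Q.G = n / Q.B ^ Q.D + 1 := by rw [hQ]; rfl
  have hQm : Q.nodeBits = (2 ^ β - 1) * (6 * β * D) := by rw [hQ]; rfl
  have hQZ : Q.Z = 2 ^ (6 * β * D + 1) := by rw [hQ]; rfl
  have hQp : Q.p = ℓ - 6 * β * D := by rw [hQ]; rfl
  have hQE : Q.E = 2 ^ (ℓ - 2 * β * D) := by rw [hQ]; rfl
  rw [← hQ] at hcons hmw ⊢
  clear hQ
  subst hQw hQD
  set D := Q.D
  rw [← hQm] at hcode hbits
  rw [← hQB] at hcode
  set B := Q.B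
  set E := Q.E
  have hw : 0 < Q.w := by omega
  have hm : Q.size ≤ 2 ^ Q.w := (Nat.le_mul_of_pos_right _ hw).trans hmw.le
  have hB : 0 < B := by rw [hQB]; positivity
  have hE : 0 < E := by rw [hQE]; positivity
  have hβD : β ≤ β * D := Nat.le_mul_of_pos_right _ hD

  have hEp : E = 2 ^ Q.p * 2 ^ (4 * β * D) := by
    rw [hQE, hQp, ← pow_add]
    congr 1
    rw [mul_assoc] at hκ ⊢
    rw [mul_assoc 4, mul_assoc 6]
    omega
  have hℓp : 2 ^ ℓ = 2 ^ Q.p * 2 ^ (6 * β * D) := by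
    rw [hQp, ← pow_add, Nat.sub_add_cancel hκ]
  -- prefix sums
  set A : ℕ → ℕ := fun j => if h : j < n then (a ⟨j, h⟩ : ℕ) else 0 with hA
  have hA' : ∀ j, A j < 2 ^ ℓ := by
    intro j
    simp only [hA]
    split_ifs
    · exact Fin.is_lt _
    · positivity
  set S : ℕ → ℕ := fun i => ∑ j ∈ Finset.range i, A j with hS
  have hSsucc : ∀ i, S (i + 1) = S i + A i := fun i => Finset.sum_range_succ _ _
  have hSle : ∀ i, S i + i ≤ i * 2 ^ ℓ := by
    intro i
    induction i with
    | zero => simp [hS]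
    | succ i ih =>
      have := hA' i
      rw [hSsucc, Nat.succ_mul]
      omega
  -- Rounded prefix sums: their increments are the labels of the leaves.
  set U : ℕ → ℕ := fun i => S i / E with hU
  have hUS : ∀ i, U i * E ≤ S i := fun i => Nat.div_mul_le_self _ _
  have hSU : ∀ i, S i < U i * E + E := fun i => Nat.lt_div_mul_add hE
  -- leaves
  set y : ℕ → ℕ := fun i => S (i + 1) - U i * E with hy
  have hyS : ∀ i, U i * E + y i = S (i + 1) := by
    intro i
    have h1 := hUS i
    have h2 := hSsucc i
    simp only [hy]
    omega
  -- S(i) exceeds U(i)·E by less than E, so y(i) < 2^ℓ + E, which is exactly `alphabetSize β D 0`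
  -- times 2^p.
  have hleaf : ∀ i, y i / 2 ^ Q.p < alphabetSize β D 0 := by
    intro i
    rw [Nat.div_lt_iff_lt_mul (by positivity)]
    have h1 := hSU i
    have h2 := hSsucc i
    have h3 := hA' i
    have h4 := hyS i
    have h5 : alphabetSize β D 0 * 2 ^ Q.p = 2 ^ ℓ + E := by
      rw [alphabetSize, hEp, hℓp, mul_zero, add_zero]; ring
    omega
  obtain ⟨z, μ, hz0, hzK, htree⟩ := exists_tree_encoding (alphabetSize β D) lab dec hcode
    (fun i => y i / 2 ^ Q.p) hleaf
  have htel₂ : ∀ k, (∀ u, U (u * B ^ k) + lab k (z k u) = U ((u + 1) * B ^ k)) → ∀ v r,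
      U (v * B ^ k) + ∑ j ∈ Finset.range r, lab k (z k (v + j)) = U ((v + r) * B ^ k) := by
    intro k hk v r
    induction r with
    | zero => simp
    | succ r ih => rw [Finset.sum_range_succ, ← add_assoc, ih, hk, add_assoc]
  -- The label of a node is the increment of U over the leaves below it; the labels of siblings
  -- telescope.
  have htel : ∀ k ≤ D, ∀ u, U (u * B ^ k) + lab k (z k u) = U ((u + 1) * B ^ k) := by
    intro k
    induction k with
    | zero =>
      intro _ u
      rw [hlab0 _ (hzK 0 (Nat.zero_le _) u), hz0]
      simp only [pow_zero, mul_one]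
      rw [Nat.div_div_eq_div_mul, ← hEp]
      change U u + y u / E = S (u + 1) / E
      rw [← hyS, mul_comm (U u) E, Nat.mul_add_div hE]
    | succ k ih =>
      intro hk u
      rw [(htree k hk u).2.1]
      have := htel₂ k (ih (by omega)) (u * B) B
      rw [pow_succ', ← mul_assoc, this, ← mul_assoc, add_mul u, one_mul]
  -- the memory
  obtain ⟨f, hf, hf'⟩ := exists_heap_array (B := B) (G := Q.G) (m := 2 ^ Q.nodeBits) D
    (fun e u => μ (D - 1 - e) u) (by positivity) (fun e he u => (htree _ (by omega) u).1)
  let base : ℕ → ℕ := fun g => U (g * B ^ D)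
  -- A table index has the mixed-radix digits level, letter, node bits and child.
  let letter : ℕ → ℕ := fun i => dec (i / B / 2 ^ Q.nodeBits / Q.Z)
    (i / B / 2 ^ Q.nodeBits % Q.Z) (i / B % 2 ^ Q.nodeBits) (i % B)
  let sum : ℕ → ℕ := fun i => ∑ j ∈ Finset.range (i % B),
    lab (i / B / 2 ^ Q.nodeBits / Q.Z) (dec (i / B / 2 ^ Q.nodeBits / Q.Z)
    (i / B / 2 ^ Q.nodeBits % Q.Z) (i / B % 2 ^ Q.nodeBits) j)
  let V := packFields Q.nodeBits f (heapStart B Q.G D)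
  let V' := packFields Q.p (fun i => y i % 2 ^ Q.p) (Q.G * B ^ D)
  refine ⟨Q.tape base (z D) letter sum V V', ?_⟩
  intro i hi hin
  obtain ⟨x, rfl⟩ : ∃ x, i = x + 1 := ⟨i - 1, by omega⟩
  have hn : n < 2 ^ Q.w := by
    have h1 : 2 ^ 1 ≤ 2 ^ ℓ := Nat.pow_le_pow_right (by norm_num) (by rw [mul_assoc] at hκ; omega)
    nlinarith
  have hGx : x < Q.G * B ^ D := by
    have := Nat.lt_mul_div_succ n (show 0 < B ^ D by positivity)
    rw [hQG, mul_comm]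
    omega
  have hxk : ∀ k ≤ D, x / B ^ k < Q.G * B ^ (D - k) := by
    intro k hk
    apply Nat.div_lt_of_lt_mul
    rw [mul_comm, mul_assoc, ← pow_add, Nat.sub_add_cancel hk]
    exact hGx
  have hxs : ∀ k, x / B ^ (k + 1) * B + x / B ^ k % B = x / B ^ k := by
    intro k
    rw [pow_succ, ← Nat.div_div_eq_div_mul]
    exact Nat.div_add_mod' _ _
  -- Nodes are numbered from the roots down, so level k lies at depth D-k.
  let id : ℕ → ℕ := fun k => heapStart B Q.G (D - k) + x / B ^ k
  have hidlt : ∀ k < D, id (k + 1) < heapStart B Q.G D := fun k hk =>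
    heapStart_add_lt (by omega) (hxk (k + 1) hk)
  have hVk : ∀ k < D, V / 2 ^ (id (k + 1) * Q.nodeBits) % 2 ^ Q.nodeBits =
      μ k (x / B ^ (k + 1)) := by
    intro k hk
    rw [mul_comm (id (k + 1)), packFields_field Q.nodeBits (fun i _ => hf i) (hidlt k hk),
      hf' (D - (k + 1)) (by omega) _ (hxk (k + 1) hk)]
    rw [show D - 1 - (D - (k + 1)) = k by omega]
  have hTS : Q.tableSize = D * Q.Z * 2 ^ Q.nodeBits * B := rfl
  have hZpos : 0 < Q.Z := by rw [hQZ]; positivity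
  have hidx : ∀ k < D, ∀ I, I = ((k * Q.Z + z (k + 1) (x / B ^ (k + 1))) * 2 ^ Q.nodeBits +
      V / 2 ^ (id (k + 1) * Q.nodeBits) % 2 ^ Q.nodeBits) * B + x / B ^ k % B →
      I < Q.tableSize ∧ I % B = x / B ^ k % B ∧
      I / B % 2 ^ Q.nodeBits = μ k (x / B ^ (k + 1)) ∧
      I / B / 2 ^ Q.nodeBits % Q.Z = z (k + 1) (x / B ^ (k + 1)) ∧
      I / B / 2 ^ Q.nodeBits / Q.Z = k := by
    rintro k hk I rfl
    have h1 : z (k + 1) (x / B ^ (k + 1)) < Q.Z := by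
      rw [hQZ]
      exact (hzK _ hk _).trans_le (alphabetSize_le hβ hk)
    have h2 := (htree k hk (x / B ^ (k + 1))).1
    have h3 := Nat.mod_lt (x / B ^ k) hB
    rw [hVk k hk, (mul_add_div_mod h3).1, (mul_add_div_mod h3).2, (mul_add_div_mod h2).1,
      (mul_add_div_mod h2).2, (mul_add_div_mod h1).1, (mul_add_div_mod h1).2, hTS]
    exact ⟨mul_add_lt (mul_add_lt (mul_add_lt hk h1) h2) h3, rfl, rfl, rfl, rfl⟩
  have hSw : S (x + 1) < 2 ^ Q.w := by
    have h1 := hSle (x + 1)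
    have h2 := Nat.mul_le_mul_right (2 ^ ℓ) hin
    omega
  have hgG : x / B ^ D < Q.G := by simpa using hxk D le_rfl
  have hTSm : Q.tableSize < 2 ^ Q.w := by
    have h1 : Q.tableSize < Q.size := by unfold Params.size; omega
    omega
  refine queryProgram_returns _ Q rfl hw hbits (by omega) hB ?_ hZpos ?_ x (by omega)
    (fun k => U (x / B ^ k * B ^ k)) (fun k => z k (x / B ^ k)) id
    (fun k => ∑ j ∈ Finset.range (x / B ^ k % B), lab k (z k (x / B ^ (k + 1) * B + j))) V V'
    (fun i hi => tape_reads_header _ _ _ _ _ _ hcons hm hi)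
    (tape_reads_base base (z D) letter sum V V' hcons hm hgG)
    (tape_reads_top base (z D) letter sum V V' hcons hm hgG)
    (by simp [id, D, heapStart, B]) ?_ ?_ ?_ ?_ ?_
    (tape_readsBits_low _ _ _ _ _ _ hcons hm hw hmw hGx) hT ?_ ?_
  · change B ^ D < 2 ^ Q.w
    rw [hQB, ← pow_mul]
    apply Nat.pow_lt_pow_right (by norm_num)
    rw [mul_assoc] at hκ
    omega
  · refine lt_of_le_of_lt ?_ hTSm
    rw [hTS, mul_assoc (D * Q.Z)]
    exact Nat.le_mul_of_pos_right _ (by positivity)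
  · intro k hk
    change heapStart B Q.G (D - k) + x / B ^ k =
      (heapStart B Q.G (D - (k + 1)) + x / B ^ (k + 1)) * B + Q.G + x / B ^ k % B
    have h1 := hxs k
    rw [show D - k = D - (k + 1) + 1 by omega, heapStart, add_mul]
    omega
  · exact fun k hk => tape_readsBits_node _ _ _ _ _ _ hcons hm hw hmw (hidlt k hk)
  · intro k hk
    obtain ⟨h1, h2, h3, h4, h5⟩ := hidx k hk _ rfl
    have h6 := tape_reads_letter base (z D) letter sum V V' hcons hm h1
    simp only [letter, h2, h3, h4, h5] at h6
    rw [(htree k hk _).2.2 _ (Nat.mod_lt _ hB), hxs] at h6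
    exact h6
  · intro k hk
    obtain ⟨h1, h2, h3, h4, h5⟩ := hidx k hk _ rfl
    have h6 := tape_reads_sum base (z D) letter sum V V' hcons hm h1
    simp only [sum, h2, h3, h4, h5] at h6
    rw [Finset.sum_congr rfl fun j hj => by
      rw [(htree k hk _).2.2 _ ((Finset.mem_range.1 hj).trans (Nat.mod_lt _ hB))]] at h6
    exact h6
  · intro k hk
    have h1 := htel₂ k (htel k hk.le) (x / B ^ (k + 1) * B) (x / B ^ k % B)
    rw [hxs] at h1
    change U (x / B ^ k * B ^ k) = U (x / B ^ (k + 1) * B ^ (k + 1)) + _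
    rw [← h1, pow_succ' B k, ← mul_assoc]
  · change U (x / B ^ 0 * B ^ 0) * E + z 0 (x / B ^ 0) * 2 ^ Q.p + _ = _
    rw [mul_comm x, packFields_field Q.p (fun i _ => Nat.mod_lt _ (by positivity)) hGx, hz0,
      sum_fin_filter_lt_eq (fun j => (a j : ℕ)) hin, pow_zero, Nat.div_one, mul_one, add_assoc,
      Nat.div_add_mod', hyS]
  · rw [sum_fin_filter_lt_eq (fun j => (a j : ℕ)) hin]
    exact hSw

end WordRAM

/-! ### The choice of the parameters -/

theorem eventually_mul_pow_le_two_rpow (K : ℝ) (k : ℕ) :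
    ∀ᶠ x : ℝ in Filter.atTop, K * x ^ k ≤ (2 : ℝ) ^ (x / 2) := by
  have hb : 0 < Real.log 2 / 2 := by have := Real.log_pos one_lt_two; positivity
  have h := (isLittleO_pow_exp_pos_mul_atTop k hb).const_mul_left K
  filter_upwards [h.bound one_pos] with x hx
  rw [one_mul, Real.norm_eq_abs, Real.norm_eq_abs, abs_of_pos (Real.exp_pos _)] at hx
  rw [Real.rpow_def_of_pos two_pos, show Real.log 2 * (x / 2) = Real.log 2 / 2 * x by ring]
  exact (le_abs_self _).trans hx

theorem half_le_two_rpow (x : ℝ) : x / 2 ≤ (2 : ℝ) ^ x := by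
  rw [Real.rpow_def_of_pos two_pos]
  have h1 := Real.add_one_le_exp (Real.log 2 * x)
  have h2 := Real.log_two_gt_d9
  rcases le_total 0 x with h | h
  · nlinarith
  · have := Real.exp_pos (Real.log 2 * x)
    linarith

/-- Let l = log(L/t). The choice β = ⌊l/2⌋ gives B ≤ √(L/t), so Bκ is of order at most √(L/t)·l·t,
which is below εL for large l. The choice D = 16⌈t⌉ gives βD ≥ 4lt, enough for the lower bound on
B^D because log L ≤ 2lt. -/
theorem exists_parameters {ε K : ℝ} (hε : 0 < ε) (hε' : ε ≤ 1 / 4) :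
    ∀ᶠ L : ℝ in Filter.atTop, 1 ≤ L ∧ 26 * K * L ^ 3 ≤ (2 : ℝ) ^ (L / 2) ∧
      ∀ t : ℝ, 1 ≤ t → t ≤ L / Real.logb 2 L →
      ∃ β D : ℕ, 2 ≤ β ∧ 1 ≤ D ∧ (D : ℝ) ≤ 32 * t ∧ t ≤ L ∧
        (2 : ℝ) ^ β * (6 * β * D) ≤ ε * L ∧ (2 : ℝ) ^ β ≤ L ∧
        1 ≤ (L / t) ^ (1 / 4 * t) ∧ (L / t) ^ (1 / 4 * t) ≤ (2 : ℝ) ^ (L / 4) ∧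
        K * L * (L / t) ^ (1 / 4 * t) ≤ ((2 : ℝ) ^ β) ^ D := by
  have hlog : Filter.Tendsto (Real.logb 2) Filter.atTop Filter.atTop :=
    Real.tendsto_logb_atTop one_lt_two
  -- Required of all larger values: t ≤ L/log L only yields log(L/t) ≥ log log L, and the bounds
  -- must hold uniformly in t.
  have hev : ∀ᶠ l : ℝ in Filter.atTop, ∀ l' ≥ l,
      4 ≤ l' ∧ 96 / ε * l' ≤ (2 : ℝ) ^ (l' / 2) ∧ K ≤ (2 : ℝ) ^ (l' / 2) := by
    rw [Filter.eventually_forall_ge_atTop]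
    have h1 := eventually_mul_pow_le_two_rpow (96 / ε) 1
    filter_upwards [h1, eventually_mul_pow_le_two_rpow K 0, Filter.eventually_ge_atTop 4]
      with l h1 h2 h3
    exact ⟨h3, by simpa using h1, by simpa using h2⟩
  filter_upwards [Filter.eventually_ge_atTop 1, eventually_mul_pow_le_two_rpow (26 * K) 3,
    (hlog.comp hlog).eventually hev, hlog.eventually_ge_atTop 1] with L hL hL3 hl hlogL
  refine ⟨hL, hL3, fun t ht htL => ?_⟩
  have hL0 : 0 < L := by linarith
  have ht0 : 0 < t := by linarith
  have hlogL0 : 0 < Real.logb 2 L := by linarith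
  have hy : Real.logb 2 L ≤ L / t := by
    rw [le_div_iff₀ ht0, mul_comm]
    exact (le_div_iff₀ hlogL0).1 htL
  have htL' : t ≤ L := htL.trans (div_le_self hL0.le hlogL)
  have hy0 : 0 < L / t := by positivity
  obtain ⟨l, hldef⟩ : ∃ l, Real.logb 2 (L / t) = l := ⟨_, rfl⟩
  have hyl : L / t = (2 : ℝ) ^ l := by
    rw [← hldef, Real.rpow_logb two_pos (by norm_num) hy0]
  obtain ⟨hl4, hl96, hlK⟩ := hl l (by
    rw [← hldef]
    exact Real.logb_le_logb_of_le one_lt_two hlogL0 hy)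
  have hLt : L = t * (2 : ℝ) ^ l := by rw [← hyl]; field_simp
  have h2half : (2 : ℝ) ^ (l / 2) * (2 : ℝ) ^ (l / 2) = (2 : ℝ) ^ l := by
    rw [← Real.rpow_add two_pos]; ring_nf
  have h2le : (2 : ℝ) ^ (l / 2) ≤ (2 : ℝ) ^ l :=
    Real.rpow_le_rpow_of_exponent_le one_le_two (by linarith)
  have hyL : (2 : ℝ) ^ l ≤ L := by
    rw [← hyl]
    exact div_le_self hL0.le ht
  have h2half1 : 1 ≤ (2 : ℝ) ^ (l / 2) := Real.one_le_rpow one_le_two (by linarith)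
  have h96 : 96 * l ≤ ε * (2 : ℝ) ^ (l / 2) := by
    have : 96 * l = ε * (96 / ε * l) := by field_simp
    rw [this]
    gcongr
  have hβle : ((⌊l / 2⌋₊ : ℕ) : ℝ) ≤ l / 2 := Nat.floor_le (by linarith)
  have hβge : l / 4 ≤ ((⌊l / 2⌋₊ : ℕ) : ℝ) := by
    have := Nat.lt_floor_add_one (l / 2)
    linarith
  have hDle : (((16 * ⌈t⌉₊ : ℕ)) : ℝ) ≤ 32 * t := by
    have := Nat.ceil_lt_add_one ht0.le
    push_cast
    linarith
  have hDge : 16 * t ≤ (((16 * ⌈t⌉₊ : ℕ)) : ℝ) := by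
    have := Nat.le_ceil t
    push_cast
    linarith
  have hβ2 : 2 ≤ ⌊l / 2⌋₊ := Nat.le_floor (by push_cast; linarith)
  have hD1 : 1 ≤ 16 * ⌈t⌉₊ := by
    have : 0 < ⌈t⌉₊ := Nat.ceil_pos.2 ht0
    omega
  generalize ⌊l / 2⌋₊ = β at *
  generalize 16 * ⌈t⌉₊ = D at *
  have hB : (2 : ℝ) ^ β ≤ (2 : ℝ) ^ (l / 2) := by
    rw [← Real.rpow_natCast]
    exact Real.rpow_le_rpow_of_exponent_le one_le_two hβle
  have hpow : (L / t) ^ (1 / 4 * t) = (2 : ℝ) ^ (l * t / 4) := by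
    rw [hyl, ← Real.rpow_mul two_pos.le]
    ring_nf
  have hlt : l * t ≤ L := by
    have h1 : ε * (2 : ℝ) ^ (l / 2) ≤ 1 / 4 * (2 : ℝ) ^ (l / 2) := by gcongr
    have h2 : l ≤ (2 : ℝ) ^ l := by linarith
    calc l * t ≤ (2 : ℝ) ^ l * t := by gcongr
      _ = L := by rw [mul_comm, ← hLt]
  have hll : Real.logb 2 L ≤ 2 * (l * t) := by
    have h1 : l = Real.logb 2 L - Real.logb 2 t := by
      rw [← hldef, Real.logb_div hL0.ne' ht0.ne']
    -- If t ≤ √L, then l ≥ (log L)/2. Otherwise t ≥ √L ≥ (log L)/4, and l ≥ 4 suffices.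
    rcases le_total (Real.logb 2 t) (Real.logb 2 L / 2) with h | h
    · nlinarith
    · have h2 : (2 : ℝ) ^ (Real.logb 2 L / 2) ≤ t := by
        calc (2 : ℝ) ^ (Real.logb 2 L / 2) ≤ (2 : ℝ) ^ Real.logb 2 t :=
              Real.rpow_le_rpow_of_exponent_le one_le_two h
          _ = t := Real.rpow_logb two_pos (by norm_num) ht0
      have h3 := half_le_two_rpow (Real.logb 2 L / 2)
      nlinarith
  refine ⟨β, D, hβ2, hD1, hDle, htL', ?_, ?_, ?_, ?_, ?_⟩
  · calc (2 : ℝ) ^ β * (6 * β * D) ≤ (2 : ℝ) ^ (l / 2) * (6 * (l / 2) * (32 * t)) := by gcongr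
      _ = (2 : ℝ) ^ (l / 2) * (96 * l) * t := by ring
      _ ≤ (2 : ℝ) ^ (l / 2) * (ε * (2 : ℝ) ^ (l / 2)) * t := by gcongr
      _ = ε * (t * ((2 : ℝ) ^ (l / 2) * (2 : ℝ) ^ (l / 2))) := by ring
      _ = ε * L := by rw [h2half, ← hLt]
  · exact hB.trans (h2le.trans hyL)
  · rw [hpow]
    exact Real.one_le_rpow one_le_two (by positivity)
  · rw [hpow]
    exact Real.rpow_le_rpow_of_exponent_le one_le_two (by linarith)
  · rw [hpow, ← pow_mul, ← Real.rpow_natCast]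
    have hlt4 : 4 * (l * t) ≤ ((β * D : ℕ) : ℝ) := by
      push_cast
      calc 4 * (l * t) = l / 4 * (16 * t) := by ring
        _ ≤ β * D := by gcongr
    have hl_lt : l ≤ l * t := le_mul_of_one_le_right (by linarith) ht
    -- The exponents add up to at most lt + 2lt + lt/4 ≤ 4lt.
    calc K * L * (2 : ℝ) ^ (l * t / 4)
        ≤ (2 : ℝ) ^ l * (2 : ℝ) ^ Real.logb 2 L * (2 : ℝ) ^ (l * t / 4) := by
          rw [Real.rpow_logb two_pos (by norm_num) hL0]
          have := hlK.trans h2le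
          gcongr
      _ = (2 : ℝ) ^ (l + Real.logb 2 L + l * t / 4) := by
          rw [Real.rpow_add two_pos, Real.rpow_add two_pos]
      _ ≤ _ := Real.rpow_le_rpow_of_exponent_le one_le_two (by linarith)

/-- In the application q = n^(1/4), N is the number of leaves of a tree, τ the size of a table and Y
the saving (L/t)^(t/4). A quarter of n/Y pays for two words for each of n/N trees. The other three
quarters, at least 3q³/4, pay for the padding, the header and the tables, which are of order at most
K·L³·q. -/
theorem redundancy_le {n ℓ w G N τ L K Y q : ℝ} (hL : 1 ≤ L) (hK : 0 < K) (hY1 : 1 ≤ Y)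
    (hq1 : 1 ≤ q) (hY : Y ≤ q) (hn : n = q * q * (q * q)) (hL3 : 26 * (8 * K) * L ^ 3 ≤ q * q)
    (hN : 8 * K * L * Y ≤ N) (hNq : N ≤ q) (hG : G * N ≤ n + N) (hτ : τ ≤ 64 * L ^ 2 * q)
    (hℓ : 0 ≤ ℓ) (hℓw : ℓ ≤ w) (hw : w ≤ K * L) :
    G * N * ℓ + 2 * G * w + 2 * τ * w + 21 * w ≤ n * ℓ + n / Y := by
  have hY0 : 0 < Y := by linarith
  have hq0 : 0 < q := by linarith
  have hL0 : 0 < L := by linarith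
  have hn0 : 0 < n := by rw [hn]; positivity
  have hw0 : 0 ≤ w := hℓ.trans hℓw
  have hN0 : 0 < N := lt_of_lt_of_le (by positivity) hN
  have hGR : G ≤ n / N + 1 := by
    rw [div_add_one hN0.ne', le_div_iff₀ hN0]
    exact hG
  have hnN : 2 * (n / N) * (K * L) ≤ n / Y / 4 := by
    rw [show 2 * (n / N) * (K * L) = 2 * n * (K * L) / N by ring, div_div,
      div_le_div_iff₀ hN0 (by positivity)]
    calc 2 * n * (K * L) * (Y * 4) = n * (8 * K * L * Y) := by ring
      _ ≤ n * N := by gcongr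
  have hqY : q * q * q ≤ n / Y := by
    rw [le_div_iff₀ hY0, hn]
    calc q * q * q * Y ≤ q * q * q * q := by gcongr
      _ = q * q * (q * q) := by ring
  have hrest : K * L * (q + 23 + 128 * L ^ 2 * q) ≤ 3 / 4 * (q * q * q) := by
    have h1 : q + 23 + 128 * L ^ 2 * q ≤ 152 * L ^ 2 * q := by
      have h2 : q ≤ L ^ 2 * q := le_mul_of_one_le_left hq0.le (one_le_pow₀ hL)
      linarith
    calc K * L * (q + 23 + 128 * L ^ 2 * q) ≤ K * L * (152 * L ^ 2 * q) :=
          mul_le_mul_of_nonneg_left h1 (by positivity)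
      _ = 152 / 208 * (26 * (8 * K) * L ^ 3) * q := by ring
      _ ≤ 152 / 208 * (q * q) * q := by gcongr
      _ ≤ _ := by
        have : 0 < q * q * q := by positivity
        linarith
  have hnN0 : 0 ≤ n / N := by positivity
  calc G * N * ℓ + 2 * G * w + 2 * τ * w + 21 * w
      ≤ (n + N) * ℓ + 2 * (n / N + 1) * w + 2 * (64 * L ^ 2 * q) * w + 21 * w := by gcongr
    _ = n * ℓ + (N * ℓ + (2 * (n / N) + 23 + 128 * L ^ 2 * q) * w) := by ring
    _ ≤ n * ℓ + (q * (K * L) + (2 * (n / N) + 23 + 128 * L ^ 2 * q) * (K * L)) := by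
        have hℓK := hℓw.trans hw
        gcongr
    _ = n * ℓ + (2 * (n / N) * (K * L) + K * L * (q + 23 + 128 * L ^ 2 * q)) := by ring
    _ ≤ n * ℓ + n / Y := by linarith

/-- The memory is small for the parameters chosen. -/
theorem layout_size_mul_le_of_parameters {n ℓ w β D : ℕ} {L t K Y : ℝ} (hL : 1 ≤ L)
    (hn : (n : ℝ) = (2 : ℝ) ^ L) (hK : 0 < K) (hL3 : 26 * (8 * K) * L ^ 3 ≤ (2 : ℝ) ^ (L / 2))
    (hDt : (D : ℝ) ≤ 32 * t) (htL : t ≤ L)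
    (hBκ : (2 : ℝ) ^ β * (6 * β * D) ≤ L / 4) (hBL : (2 : ℝ) ^ β ≤ L) (hY1 : 1 ≤ Y)
    (hY : Y ≤ (2 : ℝ) ^ (L / 4)) (hN : 8 * K * L * Y ≤ ((2 : ℝ) ^ β) ^ D)
    (hκ : 6 * β * D ≤ ℓ) (hℓw : ℓ ≤ w) (hw : (w : ℝ) ≤ K * L) :
    (((WordRAM.layout n ℓ w β D).size : ℕ) : ℝ) * w ≤ n * ℓ + n / Y := by
  have h := WordRAM.layout_size_mul_le (n := n) (w := w) hκ
  obtain ⟨G, hG⟩ : ∃ G, (WordRAM.layout n ℓ w β D).G = G := ⟨_, rfl⟩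
  have hG' : G = n / (2 ^ β) ^ D + 1 := hG.symm
  obtain ⟨τ, hτ⟩ : ∃ τ, (WordRAM.layout n ℓ w β D).tableSize = τ := ⟨_, rfl⟩
  have hτ' : τ = D * 2 ^ (6 * β * D + 1) * 2 ^ ((2 ^ β - 1) * (6 * β * D)) * 2 ^ β := hτ.symm
  rw [hG, hτ] at h
  have hGN : G * (2 ^ β) ^ D ≤ n + (2 ^ β) ^ D := by
    rw [hG', Nat.succ_mul]
    exact Nat.add_le_add_right (Nat.div_mul_le_self _ _) _
  -- The κ bits of a letter and the (B-1)κ bits of a node combine to Bκ; the factor 2 comes from Z =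
  -- 2^(κ+1).
  have hτ2 : τ = 2 * D * 2 ^ β * 2 ^ (2 ^ β * (6 * β * D)) := by
    obtain ⟨b, hb⟩ : ∃ b, 2 ^ β = b + 1 := ⟨2 ^ β - 1, by have := Nat.one_le_two_pow (n := β); omega⟩
    rw [hτ', hb, Nat.add_sub_cancel, Nat.succ_mul, pow_add, pow_succ]
    ring
  have h4 : ((2 : ℝ) ^ (2 ^ β * (6 * β * D))) ≤ (2 : ℝ) ^ (L / 4) := by
    rw [← Real.rpow_natCast]
    apply Real.rpow_le_rpow_of_exponent_le one_le_two
    push_cast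
    exact hBκ
  have hN4 : ((2 : ℝ) ^ β) ^ D ≤ (2 : ℝ) ^ (L / 4) := by
    refine le_trans ?_ h4
    rw [← pow_mul]
    apply pow_le_pow_right₀ one_le_two
    have := Nat.one_le_two_pow (n := β)
    nlinarith [Nat.zero_le (β * D)]
  obtain ⟨N, hNdef⟩ : ∃ N : ℝ, ((2 : ℝ) ^ β) ^ D = N := ⟨_, rfl⟩
  obtain ⟨q, hq⟩ : ∃ q : ℝ, (2 : ℝ) ^ (L / 4) = q := ⟨_, rfl⟩
  have hq1 : 1 ≤ q := by rw [← hq]; exact Real.one_le_rpow one_le_two (by linarith)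
  have hqq : (2 : ℝ) ^ (L / 2) = q * q := by
    rw [← hq, ← Real.rpow_add two_pos]; ring_nf
  have hn4 : (n : ℝ) = q * q * (q * q) := by
    rw [hn, ← hqq, ← Real.rpow_add two_pos]; ring_nf
  have hR : ((WordRAM.layout n ℓ w β D).size : ℝ) * w ≤
      G * N * ℓ + 2 * G * w + 2 * τ * w + 21 * w := by
    rw [← hNdef]
    exact_mod_cast h
  have hGNR : (G : ℝ) * N ≤ n + N := by
    rw [← hNdef]
    exact_mod_cast hGN
  have hτR : (τ : ℝ) ≤ 64 * L ^ 2 * q := by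
    rw [hτ2]
    push_cast
    rw [← hq]
    calc 2 * (D : ℝ) * 2 ^ β * 2 ^ (2 ^ β * (6 * β * D))
        ≤ 2 * (32 * L) * L * (2 : ℝ) ^ (L / 4) := by
          gcongr
          linarith
      _ = _ := by ring
  rw [hNdef] at hN hN4
  rw [hq] at hN4 hY
  rw [hqq] at hL3
  exact hR.trans (redundancy_le hL hK hY1 hq1 hY hn4 hL3 hN hN4 hGNR hτR (Nat.cast_nonneg _)
    (by exact_mod_cast hℓw) hw)

theorem theorem3 (c₁ c₂ c₃ : ℝ) (hc₁ : 0 < c₁) :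
    ∃ (P : WordRAM.Program) (C c : ℝ) (n₀ : ℕ), 0 < C ∧ 0 < c ∧
      ∀ (n ℓ w : ℕ) (t : ℝ), n₀ ≤ n →
        c₁ * Real.logb 2 n ≤ ℓ → ℓ ≤ c₂ * Real.logb 2 n →
        n * 2 ^ ℓ ≤ 2 ^ w → w ≤ c₃ * Real.logb 2 n →
        1 ≤ t → t ≤ Real.logb 2 n / Real.logb 2 (Real.logb 2 n) →
        ∃ m : ℕ,
          (m : ℝ) * w ≤ n * ℓ + n / (Real.logb 2 n / t) ^ (c * t) ∧
          ∀ a : Fin n → Fin (2 ^ ℓ), ∃ M : Fin m → BitVec w,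
            AnswersPrefixSums P M a (C * t) := by
  -- The bound 1/4 keeps the tables near n^(1/4) entries; the bound c₁ ensures κ ≤ ℓ.
  have hε : 0 < min (1 / 4) c₁ := lt_min (by norm_num) hc₁
  have hK : 0 < max c₃ 1 := lt_max_of_lt_right one_pos
  have hlog : Filter.Tendsto (fun n : ℕ => Real.logb 2 n) Filter.atTop Filter.atTop :=
    (Real.tendsto_logb_atTop one_lt_two).comp tendsto_natCast_atTop_atTop
  obtain ⟨n₀, hn₀⟩ := Filter.eventually_atTop.1
    ((hlog.eventually (exists_parameters (K := 8 * max c₃ 1) hε (min_le_left _ _))).and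
      (Filter.eventually_ge_atTop 2))
  -- 58 + 31·32t ≤ 1050t, as t ≥ 1.
  refine ⟨WordRAM.queryProgram, 1050, 1 / 4, n₀, by norm_num, by norm_num, ?_⟩
  intro n ℓ w t hn hℓ _ hans hw ht htL
  obtain ⟨⟨hL, hL3, hpar⟩, hn2⟩ := hn₀ n hn
  obtain ⟨β, D, hβ, hD, hDt, htL', hBκ, hBL, hY1, hY, hN⟩ := hpar t ht htL
  have hn0 : (0 : ℝ) < n := by positivity
  have hnL : (n : ℝ) = (2 : ℝ) ^ Real.logb 2 n := by
    rw [Real.rpow_logb two_pos (by norm_num) hn0]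
  generalize Real.logb 2 (n : ℝ) = L at *
  have hBκ4 : (2 : ℝ) ^ β * (6 * β * D) ≤ L / 4 := by
    have := min_le_left (1 / 4) c₁
    nlinarith
  have hκ : 6 * β * D ≤ ℓ := by
    have h1 : (6 * β * D : ℝ) ≤ (2 : ℝ) ^ β * (6 * β * D) :=
      le_mul_of_one_le_left (by positivity) (one_le_pow₀ one_le_two)
    have h2 : min (1 / 4) c₁ * L ≤ c₁ * L :=
      mul_le_mul_of_nonneg_right (min_le_right _ _) (by linarith)
    have h3 : (6 * β * D : ℝ) ≤ ℓ := by linarith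
    exact_mod_cast h3
  have hℓw : ℓ < w := by
    apply (Nat.pow_lt_pow_iff_right (a := 2) (by norm_num)).1
    have : 0 < 2 ^ ℓ := by positivity
    nlinarith
  have hLw : L ≤ w := by
    have h1 : n ≤ 2 ^ w := (Nat.le_mul_of_pos_right n (by positivity)).trans hans
    have h2 : (2 : ℝ) ^ L ≤ (2 : ℝ) ^ (w : ℝ) := by
      rw [← hnL, Real.rpow_natCast]
      exact_mod_cast h1
    exact (Real.rpow_le_rpow_left_iff one_lt_two).1 h2
  have hbits : (2 ^ β - 1) * (6 * β * D) < w := by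
    have h1 : (2 ^ β - 1) * (6 * β * D) ≤ 2 ^ β * (6 * β * D) :=
      Nat.mul_le_mul_right _ (Nat.sub_le _ _)
    have h2 : ((2 ^ β * (6 * β * D) : ℕ) : ℝ) < w := by
      push_cast
      linarith
    exact lt_of_le_of_lt h1 (by exact_mod_cast h2)
  have hwK : (w : ℝ) ≤ max c₃ 1 * L :=
    hw.trans (mul_le_mul_of_nonneg_right (le_max_left _ _) (by linarith))
  have hspace := layout_size_mul_le_of_parameters hL hnL hK hL3 hDt htL' hBκ4 hBL hY1 hY hN hκ
    hℓw.le hwK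
  -- All bit positions fit into a word: the space is at most n(ℓ+1) < n·2^ℓ ≤ 2^w.
  have hmw : (WordRAM.layout n ℓ w β D).size * w < 2 ^ w := by
    have h1 : (n : ℝ) / (L / t) ^ (1 / 4 * t) ≤ n := div_le_self hn0.le hY1
    have h2 : (WordRAM.layout n ℓ w β D).size * w ≤ n * ℓ + n := by
      have := hspace.trans (add_le_add_right h1 _)
      exact_mod_cast this
    have h3 : ∀ k, k + 3 < 2 ^ (k + 2) := by
      intro k
      induction k with
      | zero => norm_num
      | succ k ih => rw [show k + 1 + 2 = k + 2 + 1 by ring, pow_succ]; omega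
    have h4 : ℓ + 1 < 2 ^ ℓ := by
      have h5 : 2 ≤ ℓ := by nlinarith [Nat.mul_le_mul hβ hD]
      obtain ⟨k, rfl⟩ : ∃ k, ℓ = k + 2 := ⟨ℓ - 2, by omega⟩
      exact h3 k
    calc _ ≤ n * ℓ + n := h2
      _ = n * (ℓ + 1) := by ring
      _ < n * 2 ^ ℓ := Nat.mul_lt_mul_of_pos_left h4 (by omega)
      _ ≤ 2 ^ w := hans
  refine ⟨(WordRAM.layout n ℓ w β D).size, hspace, fun a => ?_⟩
  exact WordRAM.exists_representation hβ hD hκ hℓw hbits hans hmw a (by linarith)
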